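/- Consider a platform facing $n_1$ contributors (type 1) and $n_2$ pure users (type 2), whose valuations $\theta_i$ are independent and uniform on $[0,1]$. If $m_1$ contributors are admitted, a participant with valuation $\theta_i$ paying the fee $p_i$ has payoff $\theta_i m_1-p_i$; admitting a user of either type costs the platform a fixed amount $c\ge 0$. Uniform pricing: for thresholds $(\bar\theta_1,\bar\theta_2)\in[0,1]^2$ the two prices are $P_1=\bar\theta_1(1-\bar\theta_1)n_1$ and $P_2=\bar\theta_2(1-\bar\theta_1)n_1$, and the profit is $n_1(1-\bar\theta_1)(P_1-c)+n_2(1-\bar\theta_2)(P_2-c)$. Let $\Pi_U$ be its maximum over the thresholds; optimal uniform prices $P_1^*,P_2^*$ are those induced by maximizing thresholds. Differentiated pricing: let $\Pi_D$ be the supremum of the expected profit $E\sum_i\pi_i(p_i-c)$ over all measurable schemes with admissions $\pi_i(\theta)\in\{0,1\}$ and fees $p_i(\theta)$ depending on the reported valuations, with integrable payments (ex ante and given the valuation of the payer), that are individually rational and incentive compatible in expectation over the valuations of the other users. Put $S=\sqrt{4n_1^2+3n_1n_2}$ and $$p_1(n_1,n_2)=\begin{cases}0&\frac{n_1}{n_2}<\frac14\\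 \frac{4n_1-3n_2+2S}{36}&\frac{n_1}{n_2}\ge\frac14\end{cases},\qquad p_2(n_1,n_2)=\begin{cases}\frac{n_1}{2}&\frac{n_1}{n_2}<\frac14\\ \frac{n_1n_2}{4S-8n_1}&\frac{n_1}{n_2}\ge\frac14\end{cases},$$ $$\Pi(n_1,n_2)=\begin{cases}\frac{n_1n_2}{4}&\frac{n_1}{n_2}<\frac14\\ \frac{8n_1^2+9n_1n_2+(4n_1+3n_2)S}{108}&\frac{n_1}{n_2}\ge\frac14\end{cases}.$$ Theorem. (1) Let $n_2\to\infty$ and $n_1/n_2\to k\in(0,\infty)$. Optimal uniform prices exist, and for any choice of them $P_1^*=p_1(n_1,n_2)+o(n_2)$ and $P_2^*\sim p_2(n_1,n_2)$. If $k<1/4$, then $P_1^*=0$ eventually; if $k>1/4$, then $P_1^*\sim p_1(n_1,n_2)$. Moreover $\Pi_U\sim\Pi(n_1,n_2)$ and $\Pi_D\sim\Pi(n_1,n_2)$, so that $\Pi_U/\Pi_D\to1$: uniform pricing is asymptotically optimal. The expected maximal virtual surplus $E\max_{0\le m_1\le n_1,\,0\le m_2\le n_2}\big[m_1\big(\sum_{i\le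 m_1}g(\theta_{(i)})+\sum_{i\le m_2}g(\theta_{(n_1+i)})\big)-(m_1+m_2)c\big]$ is also $\sim\Pi(n_1,n_2)$, where $g(t)=2t-1$ and $\theta_{(1)}\ge\dots\ge\theta_{(n_1)}$, $\theta_{(n_1+1)}\ge\dots\ge\theta_{(n_1+n_2)}$ are the ordered valuations of each type. (2) For positive real arguments, as $n_1/n_2$ increases with $n_2$ fixed, or with $n_1+n_2$ fixed, $p_1$ is nondecreasing (zero for $n_1/n_2\le\frac14$ and strictly increasing for $n_1/n_2\ge\frac14$), and $p_2$ and $\Pi$ are strictly increasing. -/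

import Mathlib

open MeasureTheory Filter Asymptotics Topology

namespace TwoSidedMarket

/-! ### Uniform pricing -/

/-- The uniform price for contributors (type 1) at which, when type 1 uses the threshold `t₁`
(so that a fraction `1 - t₁` of the `n₁` contributors joins), the contributor with valuation `t₁`
is indifferent. -/
noncomputable def uniformPrice₁ (n₁ t₁ : ℝ) : ℝ := t₁ * ((1 - t₁) * n₁)

/-- The uniform price for pure users (type 2) at which, with thresholds `t₁` and `t₂`, the pure
user with valuation `t₂` is indifferent; only contributors count for the network value. -/
noncomputable def uniformPrice₂ (n₁ t₁ t₂ : ℝ) : ℝ := t₂ * ((1 - t₁) * n₁)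

/-- The profit of uniform pricing with thresholds `t = (t₁, t₂)` and cost `c` per admitted user,
for valuations uniformly distributed on `[0,1]`. -/
noncomputable def uniformProfit (n₁ n₂ c : ℝ) (t : ℝ × ℝ) : ℝ :=
  n₁ * (1 - t.1) * (uniformPrice₁ n₁ t.1 - c) + n₂ * (1 - t.2) * (uniformPrice₂ n₁ t.1 t.2 - c)

/-- The admissible pairs of thresholds. -/
def thresholds : Set (ℝ × ℝ) := Set.Icc 0 1 ×ˢ Set.Icc 0 1

/-- `P = (P₁, P₂)` is a pair of optimal uniform prices: it is induced by a pair of thresholds in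
`[0,1]²` that maximizes the profit. -/
def IsOptimalUniformPrices (n₁ n₂ c : ℝ) (P : ℝ × ℝ) : Prop :=
  ∃ t ∈ thresholds, IsMaxOn (uniformProfit n₁ n₂ c) thresholds t ∧
    P = (uniformPrice₁ n₁ t.1, uniformPrice₂ n₁ t.1 t.2)

/-- The optimal profit `Π_U` of uniform pricing. -/
noncomputable def profitU (n₁ n₂ c : ℝ) : ℝ := sSup (uniformProfit n₁ n₂ c '' thresholds)

/-! ### Differentiated pricing -/

/-- The users: `n₁` contributors and `n₂` pure users. -/
abbrev User (n₁ n₂ : ℕ) : Type := Fin n₁ ⊕ Fin n₂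

/-- A profile of (reported) valuations. -/
abbrev Profile (n₁ n₂ : ℕ) : Type := User n₁ n₂ → ℝ

/-- The law of the valuations: independent and uniform on `[0,1]`. -/
noncomputable def law (n₁ n₂ : ℕ) : Measure (Profile n₁ n₂) :=
  Measure.pi fun _ => volume.restrict (Set.Icc 0 1)

/-- A differentiated pricing scheme: as functions of the profile of reports, the admission
`π_i ∈ {0,1}` and the fee `p_i` of every user. -/
structure Mechanism (n₁ n₂ : ℕ) where
  join : Profile n₁ n₂ → User n₁ n₂ → ℝ
  fee : Profile n₁ n₂ → User n₁ n₂ → ℝ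
  join_eq : ∀ θ i, join θ i = 0 ∨ join θ i = 1
  measurable_join : ∀ i, Measurable fun θ => join θ i
  measurable_fee : ∀ i, Measurable fun θ => fee θ i

namespace Mechanism

variable {n₁ n₂ : ℕ} (M : Mechanism n₁ n₂)

/-- The network value under Metcalfe's law: the number of admitted contributors. -/
noncomputable def networkValue (θ : Profile n₁ n₂) : ℝ := ∑ j : Fin n₁, M.join θ (Sum.inl j)

/-- The expected payoff of user `i` with true valuation `t` who reports `s`, while the other users
report truthfully. The coordinate `i` of the integration variable is overwritten, so this is an
expectation over the valuations of the other users. -/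
noncomputable def interimPayoff (i : User n₁ n₂) (t s : ℝ) : ℝ :=
  ∫ θ, M.join (Function.update θ i s) i *
    (t * M.networkValue (Function.update θ i s) - M.fee (Function.update θ i s) i) ∂law n₁ n₂

/-- The payments have finite expectations, both ex ante and given the valuation of the payer. -/
def IntegrablePayments : Prop :=
  (∀ i, Integrable (fun θ => M.join θ i * M.fee θ i) (law n₁ n₂)) ∧
  ∀ i, ∀ s ∈ Set.Icc (0 : ℝ) 1, Integrable
    (fun θ => M.join (Function.update θ i s) i * M.fee (Function.update θ i s) i) (law n₁ n₂)

/-- Individual rationality. -/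
def IndividuallyRational : Prop :=
  ∀ i, ∀ t ∈ Set.Icc (0 : ℝ) 1, 0 ≤ M.interimPayoff i t t

/-- (Bayesian) incentive compatibility. -/
def IncentiveCompatible : Prop :=
  ∀ i, ∀ t ∈ Set.Icc (0 : ℝ) 1, ∀ s ∈ Set.Icc (0 : ℝ) 1,
    M.interimPayoff i t s ≤ M.interimPayoff i t t

/-- The expected profit `E ∑ π_i (p_i - c)` under truthful reports. -/
noncomputable def expectedProfit (c : ℝ) : ℝ :=
  ∫ θ, ∑ i, M.join θ i * (M.fee θ i - c) ∂law n₁ n₂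

end Mechanism

/-- The maximal profit `Π_D` of differentiated pricing. -/
noncomputable def profitD (n₁ n₂ : ℕ) (c : ℝ) : ℝ :=
  sSup {x | ∃ M : Mechanism n₁ n₂, M.IntegrablePayments ∧ M.IndividuallyRational ∧
    M.IncentiveCompatible ∧ x = M.expectedProfit c}

/-- The virtual valuation `g(t) = t - (1 - F(t)) / f(t)` for the uniform distribution on `[0,1]`,
where `F(t) = t` and `f(t) = 1`. -/
noncomputable def virtualValue (t : ℝ) : ℝ := t - (1 - t) / 1

/-- The sum of the `m` greatest virtual valuations (`v ∘ Tuple.sort (-v)` lists the entries of `v`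
in decreasing order). -/
noncomputable def topVirtualSum {n : ℕ} (m : ℕ) (v : Fin n → ℝ) : ℝ :=
  ∑ i : Fin n with i.val < m, virtualValue (v (Tuple.sort (fun j => -v j) i))

/-- The expected maximal virtual surplus
`∫ max_{m₁,m₂} (m₁ (∑_{i ≤ m₁} g(θ_(i)) + ∑_{i ≤ m₂} g(θ_(n₁+i))) - (m₁+m₂) c) dF^n(θ)`,
with `0 ≤ m₁ ≤ n₁` and `0 ≤ m₂ ≤ n₂`. -/
noncomputable def virtualProfit (n₁ n₂ : ℕ) (c : ℝ) : ℝ :=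
  ∫ θ, ⨆ m : Fin (n₁ + 1) × Fin (n₂ + 1),
    ((m.1.val : ℝ) * (topVirtualSum m.1.val (fun i : Fin n₁ => θ (Sum.inl i)) +
        topVirtualSum m.2.val (fun i : Fin n₂ => θ (Sum.inr i))) -
      ((m.1.val : ℝ) + m.2.val) * c) ∂law n₁ n₂

/-! ### The closed forms -/

/-- The asymptotic price of contributors. -/
noncomputable def priceFormula₁ (n₁ n₂ : ℝ) : ℝ :=
  if n₁ / n₂ < 1 / 4 then 0
  else (4 * n₁ - 3 * n₂ + 2 * √(4 * n₁ ^ 2 + 3 * n₁ * n₂)) / 36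

/-- The asymptotic price of pure users. -/
noncomputable def priceFormula₂ (n₁ n₂ : ℝ) : ℝ :=
  if n₁ / n₂ < 1 / 4 then n₁ / 2
  else n₁ * n₂ / (4 * √(4 * n₁ ^ 2 + 3 * n₁ * n₂) - 8 * n₁)

/-- The asymptotic maximal profit. -/
noncomputable def profitFormula (n₁ n₂ : ℝ) : ℝ :=
  if n₁ / n₂ < 1 / 4 then n₁ * n₂ / 4
  else (8 * n₁ ^ 2 + 9 * n₁ * n₂ + (4 * n₁ + 3 * n₂) * √(4 * n₁ ^ 2 + 3 * n₁ * n₂)) / 108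

end TwoSidedMarket

/-! In the admitted shares `x = 1 - t₁` and `y = 1 - t₂`, the uniform profit before costs is
`n₁²x²(1-x) + n₁n₂xy(1-y)`. On the unit square it is maximal at `y = 1/2` and `x = s`, where `s` is
the positive root of `n₁(2x - 3x²) + n₂/4`, or `1` if that root exceeds `1`, that is, if `n₁/n₂ <
1/4`. The closed forms are the prices and the profit at `(s, 1/2)`. The loss away from this point is
at least quadratic (`le_profitFormula_sub`), while costs are at most `c(n₁+n₂)` against a profit of
order `n₂²`. Hence every optimal pair of prices lies within `O(√n₂)` of the closed forms.

With `V` the expected maximal virtual surplus, all profits are squeezed by `Π - c(n₁+n₂) ≤ Π_U ≤ Π_D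
≤ V ≤ Π + n₁√(n₁+n₂)`. The second inequality holds because posted thresholds form an admissible
scheme (`uniformProfit_le_expectedProfit`). The third is the envelope argument of optimal auction
theory: incentive compatibility and individual rationality bound expected payments by virtual values
(`expected_payment_le`). The last is Lagrangian duality (`maxVirtualSurplus_le_excess`): fixed
thresholds bound the sums of the greatest virtual values by sums of independent excesses, whose
fluctuation is at most `√(n₁+n₂)` in mean.

For monotonicity, both ways of raising the ratio raise `n₁` and do not lower `n₁ + n₂`; the critical
ratio `1/4` is crossed by comparing both sides through the total number of users. -/

namespace TwoSidedMarket

/-! ### The closed forms in terms of the optimal share of contributors -/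

/-- The asymptotically optimal fraction of admitted contributors. -/
noncomputable def optimalShare (n₁ n₂ : ℝ) : ℝ :=
  if n₁ / n₂ < 1 / 4 then 1 else (2 * n₁ + √(4 * n₁ ^ 2 + 3 * n₁ * n₂)) / (6 * n₁)

/-- The marginal profit of the share `optimalShare n₁ n₂`, divided by `n₁`. -/
noncomputable def marginalProfit (n₁ n₂ : ℝ) : ℝ :=
  n₁ * (2 * optimalShare n₁ n₂ - 3 * optimalShare n₁ n₂ ^ 2) + n₂ / 4

section ClosedForms

variable {n₁ n₂ : ℝ}

lemma sq_sqrt_discriminant (h₁ : 0 < n₁) (h₂ : 0 < n₂) :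
    √(4 * n₁ ^ 2 + 3 * n₁ * n₂) ^ 2 = 4 * n₁ ^ 2 + 3 * n₁ * n₂ :=
  Real.sq_sqrt (by positivity)

lemma two_mul_lt_sqrt_discriminant (h₁ : 0 < n₁) (h₂ : 0 < n₂) :
    2 * n₁ < √(4 * n₁ ^ 2 + 3 * n₁ * n₂) :=
  Real.lt_sqrt_of_sq_lt (by nlinarith [mul_pos h₁ h₂])

lemma div_lt_quarter_iff (h₂ : 0 < n₂) : n₁ / n₂ < 1 / 4 ↔ 4 * n₁ < n₂ := by
  rw [div_lt_iff₀ h₂]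
  constructor <;> intro h <;> linarith

lemma sqrt_discriminant_le (h₁ : 0 < n₁) (h : n₂ ≤ 4 * n₁) :
    √(4 * n₁ ^ 2 + 3 * n₁ * n₂) ≤ 4 * n₁ :=
  Real.sqrt_le_iff.2 ⟨by linarith, by nlinarith⟩

/-- The bound `2/3` is the maximizer of `x²(1-x)`; pure users only push the share up. It supplies
the curvature in the loss estimate and places the share where `x(1-x)` decreases. -/
lemma two_thirds_le_optimalShare (h₁ : 0 < n₁) (h₂ : 0 < n₂) : 2 / 3 ≤ optimalShare n₁ n₂ := by
  unfold optimalShare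
  split_ifs with h
  · norm_num
  · rw [le_div_iff₀ (by positivity)]
    linarith [two_mul_lt_sqrt_discriminant h₁ h₂]

lemma optimalShare_le_one (h₁ : 0 < n₁) (h₂ : 0 < n₂) : optimalShare n₁ n₂ ≤ 1 := by
  unfold optimalShare
  split_ifs with h
  · norm_num
  · rw [div_lt_quarter_iff h₂] at h
    rw [div_le_iff₀ (by positivity)]
    linarith [sqrt_discriminant_le h₁ (not_lt.1 h)]

lemma marginalProfit_eq_zero (h₁ : 0 < n₁) (h₂ : 0 < n₂) (h : ¬ n₁ / n₂ < 1 / 4) :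
    marginalProfit n₁ n₂ = 0 := by
  have hS := sq_sqrt_discriminant h₁ h₂
  rw [marginalProfit, optimalShare, if_neg h]
  generalize √(4 * n₁ ^ 2 + 3 * n₁ * n₂) = S at *
  field_simp
  linear_combination (-12) * hS

lemma marginalProfit_nonneg (h₁ : 0 < n₁) (h₂ : 0 < n₂) : 0 ≤ marginalProfit n₁ n₂ := by
  by_cases h : n₁ / n₂ < 1 / 4
  · rw [marginalProfit, optimalShare, if_pos h]
    rw [div_lt_quarter_iff h₂] at h
    linarith
  · exact (marginalProfit_eq_zero h₁ h₂ h).ge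

/-- Complementary slackness: either the share is interior and the first-order condition holds, or
all contributors are admitted. -/
lemma marginalProfit_mul (h₁ : 0 < n₁) (h₂ : 0 < n₂) :
    marginalProfit n₁ n₂ * (1 - optimalShare n₁ n₂) = 0 := by
  by_cases h : n₁ / n₂ < 1 / 4
  · rw [optimalShare, if_pos h, sub_self, mul_zero]
  · simp [marginalProfit_eq_zero h₁ h₂ h]

lemma priceFormula₁_eq (h₁ : 0 < n₁) (h₂ : 0 < n₂) :
    priceFormula₁ n₁ n₂ = n₁ * optimalShare n₁ n₂ * (1 - optimalShare n₁ n₂) := by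
  unfold priceFormula₁ optimalShare
  split_ifs with h
  · simp
  · have hS := sq_sqrt_discriminant h₁ h₂
    generalize √(4 * n₁ ^ 2 + 3 * n₁ * n₂) = S at *
    field_simp
    linear_combination 36 * hS

/-- Rationalizes the denominator by `S² - (2n₁)² = 3n₁n₂`. -/
lemma priceFormula₂_eq_sqrt (h₁ : 0 < n₁) (h₂ : 0 < n₂) (h : ¬ n₁ / n₂ < 1 / 4) :
    priceFormula₂ n₁ n₂ = (2 * n₁ + √(4 * n₁ ^ 2 + 3 * n₁ * n₂)) / 12 := by
  rw [priceFormula₂, if_neg h, div_eq_iff (by linarith [two_mul_lt_sqrt_discriminant h₁ h₂])]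
  linear_combination (-1 / 3) * sq_sqrt_discriminant h₁ h₂

lemma priceFormula₂_eq (h₁ : 0 < n₁) (h₂ : 0 < n₂) :
    priceFormula₂ n₁ n₂ = n₁ * optimalShare n₁ n₂ / 2 := by
  by_cases h : n₁ / n₂ < 1 / 4
  · rw [priceFormula₂, optimalShare, if_pos h, if_pos h, mul_one]
  · rw [priceFormula₂_eq_sqrt h₁ h₂ h, optimalShare, if_neg h]
    field_simp
    ring

lemma profitFormula_eq (h₁ : 0 < n₁) (h₂ : 0 < n₂) :
    profitFormula n₁ n₂ = n₁ ^ 2 * optimalShare n₁ n₂ ^ 2 * (1 - optimalShare n₁ n₂) +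
      n₁ * n₂ * optimalShare n₁ n₂ / 4 := by
  unfold profitFormula optimalShare
  split_ifs with h
  · ring
  · have hS := sq_sqrt_discriminant h₁ h₂
    generalize √(4 * n₁ ^ 2 + 3 * n₁ * n₂) = S at *
    field_simp
    linear_combination 432 * S * hS

/-- The loss of profit, without costs, at the shares `x` and `y` of admitted users. -/
lemma le_profitFormula_sub (h₁ : 0 < n₁) (h₂ : 0 < n₂) {x : ℝ} (hx₀ : 0 ≤ x) (hx₁ : x ≤ 1)
    (y : ℝ) :
    n₁ ^ 2 * (optimalShare n₁ n₂ - x) ^ 2 / 3 + n₁ * n₂ * x * (y - 1 / 2) ^ 2 ≤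
      profitFormula n₁ n₂ - (n₁ ^ 2 * x ^ 2 * (1 - x) + n₁ * n₂ * x * y * (1 - y)) := by
  have hD := marginalProfit_nonneg h₁ h₂
  have hD' := marginalProfit_mul h₁ h₂
  have hs := two_thirds_le_optimalShare h₁ h₂
  rw [profitFormula_eq h₁ h₂]
  have hM : marginalProfit n₁ n₂ =
    n₁ * (2 * optimalShare n₁ n₂ - 3 * optimalShare n₁ n₂ ^ 2) + n₂ / 4 := rfl
  generalize optimalShare n₁ n₂ = s at *
  generalize marginalProfit n₁ n₂ = D at *
  -- Exact expansion of the cubic about `s`. The first-order term is `(s - x) * D = (1 - x) * D - (1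
  -- - s) * D`, whose last part vanishes by slackness.
  have e : n₁ ^ 2 * s ^ 2 * (1 - s) + n₁ * n₂ * s / 4 -
      (n₁ ^ 2 * x ^ 2 * (1 - x) + n₁ * n₂ * x * y * (1 - y)) =
      n₁ * n₂ * x * (y - 1 / 2) ^ 2 + n₁ ^ 2 * (s - x) ^ 2 * (2 * s + x - 1) +
        n₁ * ((1 - x) * D) := by
    linear_combination (-n₁ * (s - x)) * hM - n₁ * hD'
  rw [e]
  have h3 : 0 ≤ n₁ * ((1 - x) * D) := mul_nonneg h₁.le (mul_nonneg (by linarith) hD)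
  -- `2s + x - 1 ≥ 1/3` because `s ≥ 2/3` and `x ≥ 0`.
  have h4 : 0 ≤ n₁ ^ 2 * (s - x) ^ 2 * (2 * s + x - 1 - 1 / 3) :=
    mul_nonneg (by positivity) (by linarith)
  linarith

/-- The left side is the profit before costs at `x = 1`, `y = 1/2`. It shows that the asymptotic
profit has order at least `n₂²`, so that smaller errors are negligible. -/
lemma quarter_mul_le_profitFormula (h₁ : 0 < n₁) (h₂ : 0 < n₂) :
    n₁ * n₂ / 4 ≤ profitFormula n₁ n₂ := by
  have := le_profitFormula_sub h₁ h₂ zero_le_one le_rfl (1 / 2)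
  have h3 : 0 ≤ n₁ ^ 2 * (optimalShare n₁ n₂ - 1) ^ 2 / 3 := by positivity
  linarith

end ClosedForms

/-! ### Monotonicity of the closed forms -/

section Monotonicity

variable {x₁ x₂ y₁ y₂ : ℝ}

/-- Reduces both comparative statics, fixed `n₂` and fixed `n₁ + n₂`, to a single pair of
inequalities. -/
lemma lt_and_le_of_ratio_lt (hx₁ : 0 < x₁) (hx₂ : 0 < x₂) (hy₂ : 0 < y₂)
    (h : x₂ = y₂ ∨ x₁ + x₂ = y₁ + y₂) (hr : x₁ / x₂ < y₁ / y₂) :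
    x₁ < y₁ ∧ x₁ + x₂ ≤ y₁ + y₂ := by
  rw [div_lt_div_iff₀ hx₂ hy₂] at hr
  rcases h with rfl | h
  · have := lt_of_mul_lt_mul_right hr hx₂.le
    exact ⟨this, by linarith⟩
  · have : x₁ < y₁ := by
      by_contra! hc
      nlinarith
    exact ⟨this, h.le⟩

/-- The radicand is `x₁² + 3x₁(x₁ + x₂)`, increasing in `x₁` and in the sum. -/
lemma sqrt_discriminant_lt (hx₁ : 0 < x₁) (hx₂ : 0 < x₂) (h : x₁ < y₁)
    (hs : x₁ + x₂ ≤ y₁ + y₂) :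
    √(4 * x₁ ^ 2 + 3 * x₁ * x₂) < √(4 * y₁ ^ 2 + 3 * y₁ * y₂) := by
  apply Real.sqrt_lt_sqrt (by positivity)
  nlinarith [mul_le_mul h.le hs (by linarith) (by linarith)]

/-- Past the critical ratio the share is `1/3 + √(4 + 3n₂/n₁)/6`. -/
lemma optimalShare_lt_of_ratio (hx₁ : 0 < x₁) (hx₂ : 0 < x₂) (hy₁ : 0 < y₁) (hy₂ : 0 < y₂)
    (hr : x₁ / x₂ < y₁ / y₂) (hq : 1 / 4 ≤ x₁ / x₂) :
    optimalShare y₁ y₂ < optimalShare x₁ x₂ := by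
  rw [optimalShare, optimalShare, if_neg (not_lt.2 hq), if_neg (not_lt.2 (hq.trans hr.le)),
    div_lt_div_iff₀ (by positivity) (by positivity)]
  have h : √(4 * y₁ ^ 2 + 3 * y₁ * y₂) * x₁ < √(4 * x₁ ^ 2 + 3 * x₁ * x₂) * y₁ := by
    apply lt_of_pow_lt_pow_left₀ 2 (by positivity)
    rw [mul_pow, mul_pow, sq_sqrt_discriminant hx₁ hx₂, sq_sqrt_discriminant hy₁ hy₂]
    rw [div_lt_div_iff₀ hx₂ hy₂] at hr
    nlinarith [mul_pos hx₁ hy₁]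
  linarith

/-- In `n₁ * (s(1-s))` both factors grow: `s` falls with the ratio and stays above `1/2`. -/
lemma priceFormula₁_lt (hx₁ : 0 < x₁) (hx₂ : 0 < x₂) (hy₁ : 0 < y₁) (hy₂ : 0 < y₂)
    (h : x₁ < y₁) (hr : x₁ / x₂ < y₁ / y₂) (hq : 1 / 4 ≤ x₁ / x₂) :
    priceFormula₁ x₁ x₂ < priceFormula₁ y₁ y₂ := by
  have hs := optimalShare_lt_of_ratio hx₁ hx₂ hy₁ hy₂ hr hq
  have a := two_thirds_le_optimalShare hy₁ hy₂
  have b := optimalShare_le_one hx₁ hx₂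
  rw [priceFormula₁_eq hx₁ hx₂, priceFormula₁_eq hy₁ hy₂, mul_assoc, mul_assoc]
  apply mul_lt_mul'' h _ hx₁.le
  · exact mul_nonneg (by linarith) (by linarith)
  · nlinarith

lemma priceFormula₁_nonneg (hx₁ : 0 < x₁) (hx₂ : 0 < x₂) : 0 ≤ priceFormula₁ x₁ x₂ := by
  have a := two_thirds_le_optimalShare hx₁ hx₂
  have b := optimalShare_le_one hx₁ hx₂
  rw [priceFormula₁_eq hx₁ hx₂]
  exact mul_nonneg (mul_nonneg hx₁.le (by linarith)) (by linarith)

lemma priceFormula₁_mono (hx₁ : 0 < x₁) (hx₂ : 0 < x₂) (hy₁ : 0 < y₁) (hy₂ : 0 < y₂)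
    (h : x₁ < y₁) (hr : x₁ / x₂ < y₁ / y₂) :
    priceFormula₁ x₁ x₂ ≤ priceFormula₁ y₁ y₂ := by
  rcases lt_or_ge (x₁ / x₂) (1 / 4) with hq | hq
  · exact (if_pos hq : priceFormula₁ x₁ x₂ = 0).trans_le (priceFormula₁_nonneg hy₁ hy₂)
  · exact (priceFormula₁_lt hx₁ hx₂ hy₁ hy₂ h hr hq).le

/-- Beyond the critical ratio, the sum `n₁ + n₂` bounds the square root from below. -/
lemma four_fifths_le_sqrt_discriminant (hy₁ : 0 < y₁) (hy₂ : 0 < y₂) (h : y₂ ≤ 4 * y₁) :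
    4 * (y₁ + y₂) / 5 ≤ √(4 * y₁ ^ 2 + 3 * y₁ * y₂) := by
  apply Real.le_sqrt_of_sq_le
  -- `25(4y₁² + 3y₁y₂) - 16(y₁ + y₂)² = (4y₁ - y₂)(21y₁ + 16y₂)`.
  nlinarith [mul_nonneg (sub_nonneg.2 h) (by positivity : 0 ≤ 21 * y₁ + 16 * y₂)]

lemma priceFormula₂_lt (hx₁ : 0 < x₁) (hx₂ : 0 < x₂) (hy₁ : 0 < y₁) (hy₂ : 0 < y₂)
    (h : x₁ < y₁) (hs : x₁ + x₂ ≤ y₁ + y₂) (hr : x₁ / x₂ < y₁ / y₂) :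
    priceFormula₂ x₁ x₂ < priceFormula₂ y₁ y₂ := by
  rcases lt_or_ge (y₁ / y₂) (1 / 4) with hq | hq
  · rw [priceFormula₂, priceFormula₂, if_pos hq, if_pos (hr.trans hq)]
    linarith
  rw [priceFormula₂_eq_sqrt hy₁ hy₂ (not_lt.2 hq)]
  -- Across the critical ratio, `5x₁ < x₁ + x₂ ≤ y₁ + y₂` gives `6x₁ < 2y₁ + 4(y₁ + y₂)/5`, which is
  -- at most twelve times the new price.
  rcases lt_or_ge (x₁ / x₂) (1 / 4) with hq' | hq'
  · rw [priceFormula₂, if_pos hq']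
    have := (not_congr (div_lt_quarter_iff (n₁ := y₁) hy₂)).1 (not_lt.2 hq)
    have h4 := four_fifths_le_sqrt_discriminant hy₁ hy₂ (not_lt.1 this)
    rw [div_lt_quarter_iff hx₂] at hq'
    linarith
  · rw [priceFormula₂_eq_sqrt hx₁ hx₂ (not_lt.2 hq')]
    linarith [sqrt_discriminant_lt hx₁ hx₂ h hs]

lemma profitFormula_lt_of_quarter_le (hx₁ : 0 < x₁) (hx₂ : 0 < x₂) (hy₁ : 0 < y₁) (hy₂ : 0 < y₂)
    (h : x₁ < y₁) (hs : x₁ + x₂ ≤ y₁ + y₂) (hr : x₁ / x₂ < y₁ / y₂) (hq : 1 / 4 ≤ x₁ / x₂) :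
    profitFormula x₁ x₂ < profitFormula y₁ y₂ := by
  rw [profitFormula, profitFormula, if_neg (not_lt.2 hq), if_neg (not_lt.2 (hq.trans hr.le))]
  have hS := sqrt_discriminant_lt hx₁ hx₂ h hs
  have h1 : (4 * x₁ + 3 * x₂) * √(4 * x₁ ^ 2 + 3 * x₁ * x₂) <
      (4 * y₁ + 3 * y₂) * √(4 * y₁ ^ 2 + 3 * y₁ * y₂) :=
    mul_lt_mul'' (by linarith) hS (by positivity) (by positivity)
  have h2 : 8 * x₁ ^ 2 + 9 * x₁ * x₂ ≤ 8 * y₁ ^ 2 + 9 * y₁ * y₂ := by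
    nlinarith [mul_le_mul h.le hs (by linarith) (by linarith), mul_pos hx₁ hy₂, mul_pos hy₁ hy₂]
  linarith

lemma profitFormula_lt (hx₁ : 0 < x₁) (hx₂ : 0 < x₂) (hy₁ : 0 < y₁) (hy₂ : 0 < y₂)
    (h : x₁ < y₁) (hs : x₁ + x₂ ≤ y₁ + y₂) (hr : x₁ / x₂ < y₁ / y₂) :
    profitFormula x₁ x₂ < profitFormula y₁ y₂ := by
  rcases lt_or_ge (y₁ / y₂) (1 / 4) with hq | hq
  · rw [profitFormula, profitFormula, if_pos hq, if_pos (hr.trans hq)]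
    rw [div_lt_quarter_iff hy₂] at hq
    nlinarith
  rcases lt_or_ge (x₁ / x₂) (1 / 4) with hq' | hq'
  · rw [profitFormula, if_pos hq', profitFormula, if_neg (not_lt.2 hq)]
    have := (not_congr (div_lt_quarter_iff (n₁ := y₁) hy₂)).1 (not_lt.2 hq)
    have h4 := four_fifths_le_sqrt_discriminant hy₁ hy₂ (not_lt.1 this)
    rw [div_lt_quarter_iff hx₂] at hq'
    have h5 := mul_le_mul_of_nonneg_left h4 (by positivity : 0 ≤ 4 * y₁ + 3 * y₂)
    nlinarith [mul_pos hx₁ hx₂, mul_pos hy₁ hy₂, mul_pos hy₁ hy₁]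
  · exact profitFormula_lt_of_quarter_le hx₁ hx₂ hy₁ hy₂ h hs hr hq'

end Monotonicity

/-! ### Optimal uniform prices -/

section Uniform

variable {n₁ n₂ c : ℝ}

lemma uniformProfit_eq (n₁ n₂ c : ℝ) (t : ℝ × ℝ) : uniformProfit n₁ n₂ c t =
    n₁ ^ 2 * (1 - t.1) ^ 2 * (1 - (1 - t.1)) + n₁ * n₂ * (1 - t.1) * (1 - t.2) * (1 - (1 - t.2)) -
      c * (n₁ * (1 - t.1) + n₂ * (1 - t.2)) := by
  unfold uniformProfit uniformPrice₁ uniformPrice₂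
  ring

lemma exists_isMaxOn_uniformProfit (n₁ n₂ c : ℝ) :
    ∃ t ∈ thresholds, IsMaxOn (uniformProfit n₁ n₂ c) thresholds t := by
  apply IsCompact.exists_isMaxOn (isCompact_Icc.prod isCompact_Icc)
  · exact ⟨(0, 0), by constructor <;> simp⟩
  · unfold uniformProfit uniformPrice₁ uniformPrice₂
    fun_prop

lemma exists_isOptimalUniformPrices (n₁ n₂ c : ℝ) : ∃ P, IsOptimalUniformPrices n₁ n₂ c P := by
  obtain ⟨t, ht, hmax⟩ := exists_isMaxOn_uniformProfit n₁ n₂ c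
  exact ⟨_, t, ht, hmax, rfl⟩

lemma profitU_eq_of_isMaxOn {t : ℝ × ℝ} (ht : t ∈ thresholds)
    (hmax : IsMaxOn (uniformProfit n₁ n₂ c) thresholds t) :
    profitU n₁ n₂ c = uniformProfit n₁ n₂ c t :=
  IsGreatest.csSup_eq ⟨Set.mem_image_of_mem _ ht, by rintro _ ⟨s, hs, rfl⟩; exact hmax hs⟩

lemma profitFormula_sub_le_profitU (h₁ : 0 < n₁) (h₂ : 0 < n₂) (hc : 0 ≤ c) :
    profitFormula n₁ n₂ - c * (n₁ + n₂) ≤ profitU n₁ n₂ c := by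
  obtain ⟨t, ht, hmax⟩ := exists_isMaxOn_uniformProfit n₁ n₂ c
  have a := two_thirds_le_optimalShare h₁ h₂
  have b := optimalShare_le_one h₁ h₂
  rw [profitU_eq_of_isMaxOn ht hmax]
  have hmem : (1 - optimalShare n₁ n₂, (1 : ℝ) / 2) ∈ thresholds := by
    constructor <;> constructor <;> simp only <;> linarith
  have h : uniformProfit n₁ n₂ c (1 - optimalShare n₁ n₂, (1 : ℝ) / 2) ≤ _ := hmax hmem
  refine le_trans ?_ h
  rw [uniformProfit_eq, profitFormula_eq h₁ h₂]
  simp only [sub_sub_cancel]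
  have : c * (n₁ * optimalShare n₁ n₂ + n₂ * (1 - 1 / 2)) ≤ c * (n₁ + n₂) := by
    gcongr
    · nlinarith
    · linarith
  linarith

/-- At optimal thresholds the loss of profit is at most the total cost of admission. -/
lemma loss_le_cost (h₁ : 0 < n₁) (h₂ : 0 < n₂) (hc : 0 ≤ c) {t : ℝ × ℝ} (ht : t ∈ thresholds)
    (hmax : IsMaxOn (uniformProfit n₁ n₂ c) thresholds t) :
    n₁ ^ 2 * (optimalShare n₁ n₂ - (1 - t.1)) ^ 2 / 3 +
      n₁ * n₂ * (1 - t.1) * (1 - t.2 - 1 / 2) ^ 2 ≤ c * (n₁ + n₂) := by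
  obtain ⟨⟨ha, hb⟩, hd, he⟩ := ht
  have h := profitFormula_sub_le_profitU h₁ h₂ hc
  rw [profitU_eq_of_isMaxOn ⟨⟨ha, hb⟩, hd, he⟩ hmax, uniformProfit_eq] at h
  have h' := le_profitFormula_sub h₁ h₂ (sub_nonneg.2 hb) (by linarith : 1 - t.1 ≤ 1) (1 - t.2)
  have : 0 ≤ c * (n₁ * (1 - t.1) + n₂ * (1 - t.2)) :=
    mul_nonneg hc (add_nonneg (mul_nonneg h₁.le (by linarith)) (mul_nonneg h₂.le (by linarith)))
  linarith

lemma sq_price₁_sub_le (h₁ : 0 < n₁) (h₂ : 0 < n₂) (hc : 0 ≤ c) {P : ℝ × ℝ}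
    (hP : IsOptimalUniformPrices n₁ n₂ c P) :
    (P.1 - priceFormula₁ n₁ n₂) ^ 2 ≤ (3 + 2 * (n₁ / n₂)) * (c * (n₁ + n₂)) := by
  obtain ⟨t, ht, hmax, rfl⟩ := hP
  have h := loss_le_cost h₁ h₂ hc ht hmax
  obtain ⟨⟨ha, hb⟩, hd, he⟩ := ht
  have a := two_thirds_le_optimalShare h₁ h₂
  have b := optimalShare_le_one h₁ h₂
  rw [priceFormula₁_eq h₁ h₂, uniformPrice₁]
  generalize optimalShare n₁ n₂ = s at *
  have e : t.1 * ((1 - t.1) * n₁) - n₁ * s * (1 - s) =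
    n₁ * (s - (1 - t.1)) * (s - t.1) := by ring
  have h2 : (s - t.1) ^ 2 ≤ 1 := by
    rw [sq_le_one_iff_abs_le_one, abs_le]
    constructor <;> linarith
  have h3 : 0 ≤ n₁ * n₂ * (1 - t.1) * (1 - t.2 - 1 / 2) ^ 2 :=
    mul_nonneg (mul_nonneg (by positivity) (by linarith)) (sq_nonneg _)
  -- The loss bound alone gives the constant `3`; the extra term is only there so that both prices
  -- share one estimate.
  have h4 : 0 ≤ 2 * (n₁ / n₂) * (c * (n₁ + n₂)) := by positivity
  calc _ = n₁ ^ 2 * (s - (1 - t.1)) ^ 2 * (s - t.1) ^ 2 := by rw [e]; ring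
    _ ≤ n₁ ^ 2 * (s - (1 - t.1)) ^ 2 * 1 := by gcongr
    _ ≤ _ := by linarith

/-- Up to sign the deviation is `n₁(s-x)/2 + n₁x(y-1/2)`. Each square is controlled by one term of
the loss, the second after multiplication by `n₁x/n₂ ≤ n₁/n₂`. -/
lemma sq_price₂_sub_le (h₁ : 0 < n₁) (h₂ : 0 < n₂) (hc : 0 ≤ c) {P : ℝ × ℝ}
    (hP : IsOptimalUniformPrices n₁ n₂ c P) :
    (P.2 - priceFormula₂ n₁ n₂) ^ 2 ≤ (3 + 2 * (n₁ / n₂)) * (c * (n₁ + n₂)) := by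
  obtain ⟨t, ht, hmax, rfl⟩ := hP
  have h := loss_le_cost h₁ h₂ hc ht hmax
  obtain ⟨⟨ha, hb⟩, hd, he⟩ := ht
  rw [priceFormula₂_eq h₁ h₂, uniformPrice₂]
  generalize optimalShare n₁ n₂ = s at *
  have h0 : 0 ≤ 1 - t.1 := by linarith
  have h3 : 0 ≤ n₁ * n₂ * (1 - t.1) * (1 - t.2 - 1 / 2) ^ 2 := by positivity
  have h5 : n₁ ^ 2 * (1 - t.1) ^ 2 * (1 - t.2 - 1 / 2) ^ 2 ≤ n₁ / n₂ * (c * (n₁ + n₂)) := by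
    calc _ = n₁ / n₂ * (n₁ * n₂ * (1 - t.1) * (1 - t.2 - 1 / 2) ^ 2) * (1 - t.1) := by
          field_simp
      _ ≤ n₁ / n₂ * (n₁ * n₂ * (1 - t.1) * (1 - t.2 - 1 / 2) ^ 2) * 1 := by
          gcongr; linarith
      _ ≤ _ := by
          rw [mul_one]
          have : 0 ≤ n₁ ^ 2 * (s - (1 - t.1)) ^ 2 / 3 := by positivity
          exact mul_le_mul_of_nonneg_left (by linarith) (by positivity)
  have h6 : 0 ≤ c * (n₁ + n₂) := by positivity
  calc _ ≤ 2 * (n₁ ^ 2 * (s - (1 - t.1)) ^ 2 / 4 +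
        n₁ ^ 2 * (1 - t.1) ^ 2 * (1 - t.2 - 1 / 2) ^ 2) := by
        nlinarith [sq_nonneg (n₁ * (s - (1 - t.1)) / 2 - n₁ * (1 - t.1) * (1 - t.2 - 1 / 2))]
    _ ≤ _ := by nlinarith

end Uniform

/-! ### Asymptotics of the uniform prices -/

section Asymptotics

variable {a b : ℕ → ℝ} {c k : ℝ}

lemma eventually_pos_of_ratio (hk : 0 < k) (hb : Tendsto b atTop atTop)
    (hr : Tendsto (fun j => a j / b j) atTop (𝓝 k)) : ∀ᶠ j in atTop, 0 < a j ∧ 0 < b j := by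
  filter_upwards [hb.eventually_gt_atTop 0, hr.eventually_const_lt hk] with j h1 h2
  exact ⟨(div_pos_iff_of_pos_right h1).1 h2, h1⟩

lemma tendsto_cost_div_sq (c : ℝ) (hb : Tendsto b atTop atTop)
    (hr : Tendsto (fun j => a j / b j) atTop (𝓝 k)) :
    Tendsto (fun j => c * (a j + b j) / b j ^ 2) atTop (𝓝 0) := by
  have h : Tendsto (fun j => c * (a j / b j + 1) * (b j)⁻¹) atTop (𝓝 (c * (k + 1) * 0)) :=
    ((hr.add_const 1).const_mul c).mul hb.inv_tendsto_atTop
  rw [mul_zero] at h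
  refine h.congr' ?_
  filter_upwards [hb.eventually_gt_atTop 0] with j hj
  field_simp

/-- The right side of the hypothesis is `O(b)`, so the deviation itself is `O(√b)`. -/
lemma isLittleO_of_sq_le (hb : Tendsto b atTop atTop)
    (hr : Tendsto (fun j => a j / b j) atTop (𝓝 k)) {u v : ℕ → ℝ}
    (h : ∀ᶠ j in atTop, (u j - v j) ^ 2 ≤ (3 + 2 * (a j / b j)) * (c * (a j + b j))) :
    (fun j => u j - v j) =o[atTop] b := by
  have h0 : Tendsto (fun j => (3 + 2 * (a j / b j)) * (c * (a j + b j) / b j ^ 2)) atTop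
      (𝓝 ((3 + 2 * k) * 0)) := ((hr.const_mul 2).const_add 3).mul (tendsto_cost_div_sq c hb hr)
  rw [mul_zero] at h0
  have h1 : Tendsto (fun j => ((u j - v j) / b j) ^ 2) atTop (𝓝 0) := by
    refine squeeze_zero' (Eventually.of_forall fun j => sq_nonneg _) ?_ h0
    filter_upwards [h, hb.eventually_gt_atTop 0] with j hj hj'
    rw [div_pow, ← mul_div_assoc]
    gcongr
  rw [isLittleO_iff_tendsto' (by
    filter_upwards [hb.eventually_gt_atTop 0] with j hj h'
    exact absurd h' hj.ne')]
  have h2 := h1.sqrt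
  simp only [Real.sqrt_sq_eq_abs, Real.sqrt_zero] at h2
  exact (tendsto_zero_iff_abs_tendsto_zero _).2 h2

lemma isBigO_of_mul_le {u : ℕ → ℝ} {ε : ℝ} (hε : 0 < ε) (hb : Tendsto b atTop atTop)
    (h : ∀ᶠ j in atTop, ε * b j ≤ u j) : b =O[atTop] u := by
  refine IsBigO.of_bound ε⁻¹ ?_
  filter_upwards [h, hb.eventually_gt_atTop 0] with j hj hj'
  rw [Real.norm_of_nonneg hj'.le, Real.norm_of_nonneg ((by positivity : 0 ≤ ε * b j).trans hj),
    inv_mul_eq_div, le_div_iff₀ hε]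
  linarith

lemma isEquivalent_price₂ (hc : 0 ≤ c) (hk : 0 < k) (hb : Tendsto b atTop atTop)
    (hr : Tendsto (fun j => a j / b j) atTop (𝓝 k)) {P : ℕ → ℝ × ℝ}
    (hP : ∀ᶠ j in atTop, IsOptimalUniformPrices (a j) (b j) c (P j)) :
    (fun j => (P j).2) ~[atTop] (fun j => priceFormula₂ (a j) (b j)) := by
  have hpos := eventually_pos_of_ratio hk hb hr
  have h1 : (fun j => (P j).2 - priceFormula₂ (a j) (b j)) =o[atTop] b := by
    apply isLittleO_of_sq_le hb hr (c := c)
    filter_upwards [hpos, hP] with j hj hj'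
    exact sq_price₂_sub_le hj.1 hj.2 hc hj'
  refine h1.trans_isBigO (isBigO_of_mul_le (by positivity : 0 < k / 6) hb ?_)
  filter_upwards [hpos, hr.eventually_const_lt (half_lt_self hk)] with j hj hj'
  rw [lt_div_iff₀ hj.2] at hj'
  rw [priceFormula₂_eq hj.1 hj.2]
  have := two_thirds_le_optimalShare hj.1 hj.2
  nlinarith [hj.1]

lemma isLittleO_price₁ (hc : 0 ≤ c) (hk : 0 < k) (hb : Tendsto b atTop atTop)
    (hr : Tendsto (fun j => a j / b j) atTop (𝓝 k)) {P : ℕ → ℝ × ℝ}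
    (hP : ∀ᶠ j in atTop, IsOptimalUniformPrices (a j) (b j) c (P j)) :
    (fun j => (P j).1 - priceFormula₁ (a j) (b j)) =o[atTop] b := by
  apply isLittleO_of_sq_le hb hr (c := c)
  filter_upwards [eventually_pos_of_ratio hk hb hr, hP] with j hj hj'
  exact sq_price₁_sub_le hj.1 hj.2 hc hj'

lemma isEquivalent_price₁_of_quarter_lt (hc : 0 ≤ c) (hk : 1 / 4 < k) (hb : Tendsto b atTop atTop)
    (hr : Tendsto (fun j => a j / b j) atTop (𝓝 k)) {P : ℕ → ℝ × ℝ}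
    (hP : ∀ᶠ j in atTop, IsOptimalUniformPrices (a j) (b j) c (P j)) :
    (fun j => (P j).1) ~[atTop] (fun j => priceFormula₁ (a j) (b j)) := by
  have hk0 : 0 < k := by linarith
  have hlim : Tendsto (fun j => (4 * (a j / b j) - 3 +
      2 * √(4 * (a j / b j) ^ 2 + 3 * (a j / b j))) / 36) atTop
      (𝓝 ((4 * k - 3 + 2 * √(4 * k ^ 2 + 3 * k)) / 36)) :=
    (((hr.const_mul 4).sub_const 3).add
      ((((hr.pow 2).const_mul 4).add (hr.const_mul 3)).sqrt.const_mul 2)).div_const 36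
  -- At `k = 1/4` the root equals `1` and the limit is `0`; this is why an equivalence needs `k`
  -- away from `1/4`.
  have hl : 0 < (4 * k - 3 + 2 * √(4 * k ^ 2 + 3 * k)) / 36 := by
    have : 1 < √(4 * k ^ 2 + 3 * k) := Real.lt_sqrt_of_sq_lt (by nlinarith)
    linarith
  refine (isLittleO_price₁ hc hk0 hb hr hP).trans_isBigO
    (isBigO_of_mul_le (half_pos hl) hb ?_)
  filter_upwards [eventually_pos_of_ratio hk0 hb hr, hr.eventually_const_lt hk,
    hlim.eventually_const_lt (half_lt_self hl)] with j hj hj' hj''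
  rw [priceFormula₁, if_neg (not_lt.2 hj'.le)]
  have e : √(4 * a j ^ 2 + 3 * a j * b j) = √(4 * (a j / b j) ^ 2 + 3 * (a j / b j)) * b j := by
    rw [← Real.sqrt_sq hj.2.le, ← Real.sqrt_mul', Real.sqrt_sq hj.2.le]
    · congr 1
      have := hj.2
      field_simp
    · positivity
  rw [e]
  have e' : a j = a j / b j * b j := (div_mul_cancel₀ _ hj.2.ne').symm
  generalize √(4 * (a j / b j) ^ 2 + 3 * (a j / b j)) = S at *
  generalize a j / b j = r at *
  rw [e']
  nlinarith [hj.2]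

/-- If free admission of all contributors is not optimal, pure users are charged a price far
from the one induced by the profit-maximizing threshold `1/2`. -/
lemma le_sq_of_price₁_ne_zero {n₁ n₂ : ℝ} (h₁ : 0 < n₁) {t : ℝ × ℝ}
    (ht : t ∈ thresholds) (hmax : IsMaxOn (uniformProfit n₁ n₂ c) thresholds t)
    (h : t.1 ≠ 0) : n₂ / 4 - n₁ - c ≤ n₂ * (1 - t.2 - 1 / 2) ^ 2 := by
  obtain ⟨⟨ha, hb⟩, hd, he⟩ := ht
  have hmem : ((0 : ℝ), t.2) ∈ thresholds := ⟨⟨le_rfl, zero_le_one⟩, hd, he⟩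
  have hle : uniformProfit n₁ n₂ c (0, t.2) ≤ uniformProfit n₁ n₂ c t := hmax hmem
  simp only [uniformProfit, uniformPrice₁, uniformPrice₂] at hle
  have hpos : 0 < t.1 := lt_of_le_of_ne ha (Ne.symm h)
  have h2 : n₁ * t.1 * (n₂ * t.2 * (1 - t.2) - n₁ * (1 - t.1) ^ 2 - c) ≤ 0 := by linarith
  have h3 : n₂ * t.2 * (1 - t.2) - n₁ * (1 - t.1) ^ 2 - c ≤ 0 := by
    by_contra! hc'
    exact absurd h2 (not_le.2 (by positivity))
  have h4 : n₁ * (1 - t.1) ^ 2 ≤ n₁ := by nlinarith [mul_pos h₁ hpos]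
  linarith

/-- If contributors pay, comparison with free admission forces `n₂(y - 1/2)²` to grow at least like
`(1/4 - k)n₂`, whereas the loss bound, with `x ≥ 1/2`, keeps it below `2c(n₁+n₂)/n₁`, which stays
bounded. -/
lemma eventually_price₁_eq_zero (hc : 0 ≤ c) (hk : 0 < k) (hk' : k < 1 / 4)
    (hb : Tendsto b atTop atTop) (hr : Tendsto (fun j => a j / b j) atTop (𝓝 k))
    {P : ℕ → ℝ × ℝ} (hP : ∀ᶠ j in atTop, IsOptimalUniformPrices (a j) (b j) c (P j)) :
    ∀ᶠ j in atTop, (P j).1 = 0 := by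
  have hδ := tendsto_cost_div_sq c hb hr
  have l1 : Tendsto (fun j => 3 * (c * (a j + b j) / b j ^ 2) / (a j / b j) ^ 2) atTop
      (𝓝 (3 * 0 / k ^ 2)) := (hδ.const_mul 3).div (hr.pow 2) (by positivity)
  have l2 : Tendsto (fun j => 1 / 4 - a j / b j - c * (b j)⁻¹ -
      2 * (c * (a j + b j) / b j ^ 2) / (a j / b j)) atTop
      (𝓝 (1 / 4 - k - c * 0 - 2 * 0 / k)) :=
    ((hr.const_sub _).sub (hb.inv_tendsto_atTop.const_mul c)).sub
      ((hδ.const_mul 2).div hr hk.ne')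
  simp only [mul_zero, zero_div, sub_zero] at l1 l2
  filter_upwards [eventually_pos_of_ratio hk hb hr, hP,
    l1.eventually_lt_const (by norm_num : (0 : ℝ) < 1 / 36),
    l2.eventually_const_lt (sub_pos.2 hk')] with j ⟨h₁, h₂⟩ hj e1 e2
  obtain ⟨t, ht, hmax, hPt⟩ := hj
  rw [hPt]
  have hloss := loss_le_cost h₁ h₂ hc ht hmax
  by_contra hne
  have hne' : t.1 ≠ 0 := fun h => hne (by simp [uniformPrice₁, h])
  have hq := le_sq_of_price₁_ne_zero h₁ ht hmax hne'
  obtain ⟨⟨ha, hb⟩, hd, he⟩ := ht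
  have h0 : 0 ≤ 1 - t.1 := by linarith
  have hs := two_thirds_le_optimalShare h₁ h₂
  have h3 : 0 ≤ a j * b j * (1 - t.1) * (1 - t.2 - 1 / 2) ^ 2 := by positivity
  have h4 : 0 ≤ a j ^ 2 * (optimalShare (a j) (b j) - (1 - t.1)) ^ 2 / 3 := by positivity
  -- The loss bound makes `|s - x| < 1/6` eventually, and `2/3 - 1/6 = 1/2`.
  have hx : 1 / 2 ≤ 1 - t.1 := by
    have : (optimalShare (a j) (b j) - (1 - t.1)) ^ 2 < (1 / 6) ^ 2 := by
      have e : 3 * (c * (a j + b j) / b j ^ 2) / (a j / b j) ^ 2 =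
          3 * (c * (a j + b j)) / a j ^ 2 := by field_simp
      rw [e, div_lt_iff₀ (by positivity)] at e1
      have : a j ^ 2 * (optimalShare (a j) (b j) - (1 - t.1)) ^ 2 < a j ^ 2 * (1 / 6) ^ 2 := by
        linarith
      exact lt_of_mul_lt_mul_left this (by positivity)
    have := lt_of_pow_lt_pow_left₀ 2 (by norm_num) this
    linarith
  have h5 : a j * b j * (1 / 2) * (1 - t.2 - 1 / 2) ^ 2 ≤ c * (a j + b j) := by
    refine le_trans ?_ (by linarith : a j * b j * (1 - t.1) * (1 - t.2 - 1 / 2) ^ 2 ≤ _)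
    gcongr
  have h6 : b j * (1 - t.2 - 1 / 2) ^ 2 ≤ 2 * (c * (a j + b j)) / a j := by
    rw [le_div_iff₀ h₁]
    linarith
  have e : 1 / 4 - a j / b j - c * (b j)⁻¹ - 2 * (c * (a j + b j) / b j ^ 2) / (a j / b j) =
      (b j / 4 - a j - c - 2 * (c * (a j + b j)) / a j) / b j := by field_simp
  rw [e] at e2
  have := (div_pos_iff_of_pos_right h₂).1 e2
  linarith

/-- A quantity within `O(n₁ + n₂) + O(n₁ √(n₁ + n₂))` of the asymptotic profit is equivalent
to it. -/
lemma isEquivalent_profitFormula (hk : 0 < k) (hb : Tendsto b atTop atTop)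
    (hr : Tendsto (fun j => a j / b j) atTop (𝓝 k)) {V : ℕ → ℝ} {C : ℝ}
    (hlow : ∀ᶠ j in atTop, profitFormula (a j) (b j) - c * (a j + b j) ≤ V j)
    (hup : ∀ᶠ j in atTop, V j ≤ profitFormula (a j) (b j) + C * (a j * √(a j + b j))) :
    V ~[atTop] fun j => profitFormula (a j) (b j) := by
  have hb2 : Tendsto (fun j => b j ^ 2) atTop atTop := (tendsto_pow_atTop two_ne_zero).comp hb
  have hpos := eventually_pos_of_ratio hk hb hr
  have l1 := tendsto_cost_div_sq c hb hr
  have l2 : Tendsto (fun j => C * (a j / b j) * √(1 * (a j + b j) / b j ^ 2)) atTop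
      (𝓝 (C * k * √0)) := (hr.const_mul C).mul (tendsto_cost_div_sq 1 hb hr).sqrt
  rw [Real.sqrt_zero, mul_zero] at l2
  have l1' := l1.neg
  rw [neg_zero] at l1'
  have key : (fun j => V j - profitFormula (a j) (b j)) =o[atTop] fun j => b j ^ 2 := by
    rw [isLittleO_iff_tendsto' (by
      filter_upwards [hb2.eventually_gt_atTop 0] with j hj h'
      exact absurd h' hj.ne')]
    refine tendsto_of_tendsto_of_tendsto_of_le_of_le' l1' l2 ?_ ?_
    · filter_upwards [hlow, hb2.eventually_gt_atTop 0] with j hj hj'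
      rw [← neg_div]
      gcongr
      linarith
    · filter_upwards [hup, hpos] with j hj hj'
      have h₂ := hj'.2
      have e : C * (a j / b j) * √(1 * (a j + b j) / b j ^ 2) =
          C * (a j * √(a j + b j)) / b j ^ 2 := by
        rw [one_mul, Real.sqrt_div' _ (by positivity), Real.sqrt_sq h₂.le]
        field_simp
      rw [e]
      gcongr
      linarith
  -- `Π ≥ n₁n₂/4` and eventually `n₁ > kn₂/2`.
  refine key.trans_isBigO (isBigO_of_mul_le (by positivity : 0 < k / 8) hb2 ?_)
  filter_upwards [hpos, hr.eventually_const_lt (half_lt_self hk)] with j hj hj'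
  rw [lt_div_iff₀ hj.2] at hj'
  refine le_trans ?_ (quarter_mul_le_profitFormula hj.1 hj.2)
  nlinarith [hj.2]

end Asymptotics

/-! ### The law of the valuations -/

/-- The uniform distribution on `[0,1]`. -/
noncomputable abbrev unif : Measure ℝ := volume.restrict (Set.Icc 0 1)

instance : IsProbabilityMeasure unif := ⟨by simp [unif]⟩

lemma law_eq (n₁ n₂ : ℕ) : law n₁ n₂ = Measure.pi fun _ => unif := rfl

instance (n₁ n₂ : ℕ) : IsProbabilityMeasure (law n₁ n₂) := by
  rw [law_eq]; infer_instance

lemma integral_unif (f : ℝ → ℝ) : ∫ t, f t ∂unif = ∫ t in (0 : ℝ)..1, f t := by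
  rw [intervalIntegral.integral_of_le zero_le_one, integral_Icc_eq_integral_Ioc]

variable {n₁ n₂ : ℕ}

lemma ae_mem_Icc (n₁ n₂ : ℕ) : ∀ᵐ θ ∂law n₁ n₂, ∀ i, θ i ∈ Set.Icc (0 : ℝ) 1 := by
  rw [ae_all_iff]
  intro i
  exact (measurePreserving_eval (fun _ : User n₁ n₂ => unif) i).quasiMeasurePreserving.ae
    (ae_restrict_mem measurableSet_Icc)

/-- Redrawing one coordinate does not change the law. -/
lemma measurePreserving_update (i : User n₁ n₂) :
    MeasurePreserving (fun p : ℝ × Profile n₁ n₂ => Function.update p.2 i p.1)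
      (unif.prod (law n₁ n₂)) (law n₁ n₂) := by
  have hm : Measurable fun p : ℝ × Profile n₁ n₂ => Function.update p.2 i p.1 := by
    rw [measurable_pi_iff]
    intro j
    by_cases h : j = i
    · subst h
      simpa using measurable_fst
    · simpa [h, Function.comp_def] using (measurable_pi_apply j).comp measurable_snd
  refine ⟨hm, ?_⟩
  rw [law_eq]
  symm
  apply Measure.pi_eq
  intro s hs
  rw [Measure.map_apply hm (.univ_pi hs)]
  -- The overwritten coordinate of the profile is unconstrained and contributes the factor `1`.
  have e : (fun p : ℝ × Profile n₁ n₂ => Function.update p.2 i p.1) ⁻¹' Set.univ.pi s =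
      s i ×ˢ Set.univ.pi (Function.update s i Set.univ) := by
    ext p
    simp only [Set.mem_preimage, Set.mem_pi, Set.mem_univ, true_imp_iff, Set.mem_prod]
    constructor
    · intro h
      refine ⟨by simpa using h i, fun j => ?_⟩
      by_cases hj : j = i
      · subst hj; simp
      · simpa [hj] using h j
    · rintro ⟨h1, h2⟩ j
      by_cases hj : j = i
      · subst hj; simpa using h1
      · simpa [hj] using h2 j
  rw [e, Measure.prod_prod, Measure.pi_pi, ← Finset.mul_prod_erase _ _ (Finset.mem_univ i),
    ← Finset.mul_prod_erase Finset.univ (fun j => unif (s j)) (Finset.mem_univ i)]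
  simp only [Function.update_self, measure_univ, one_mul]
  congr 1
  refine Finset.prod_congr rfl fun j hj => ?_
  rw [Function.update_of_ne (Finset.ne_of_mem_erase hj)]

/-- Conditioning on the valuation of one user. -/
lemma integral_law_eq (i : User n₁ n₂) {F : Profile n₁ n₂ → ℝ} (hF : Integrable F (law n₁ n₂)) :
    Integrable (fun s => ∫ θ, F (Function.update θ i s) ∂law n₁ n₂) unif ∧
    ∫ θ, F θ ∂law n₁ n₂ = ∫ s, ∫ θ, F (Function.update θ i s) ∂law n₁ n₂ ∂unif := by
  have hp := measurePreserving_update (n₁ := n₁) (n₂ := n₂) i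
  have hI : Integrable (fun p : ℝ × Profile n₁ n₂ => F (Function.update p.2 i p.1))
      (unif.prod (law n₁ n₂)) := hp.integrable_comp_of_integrable hF
  refine ⟨hI.integral_prod_left, ?_⟩
  rw [← integral_prod _ hI]
  conv_lhs => rw [← hp.map_eq]
  exact integral_map hp.measurable.aemeasurable (by rw [hp.map_eq]; exact hF.aestronglyMeasurable)

/-! ### Posted thresholds as a differentiated pricing scheme -/

section Threshold

open scoped Classical in
/-- Every user whose report reaches the threshold of the type is admitted, and pays the threshold
times the realized number of contributors. -/
noncomputable def thresholdMechanism (n₁ n₂ : ℕ) (τ : User n₁ n₂ → ℝ) : Mechanism n₁ n₂ where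
  join θ i := if τ i ≤ θ i then 1 else 0
  fee θ i := τ i * ∑ j : Fin n₁, if τ (.inl j) ≤ θ (.inl j) then 1 else 0
  join_eq θ i := by split_ifs <;> simp
  measurable_join i := Measurable.ite (measurableSet_le measurable_const (measurable_pi_apply i))
    measurable_const measurable_const
  measurable_fee i := by
    refine (Finset.measurable_sum _ fun j _ => ?_).const_mul _
    exact Measurable.ite (measurableSet_le measurable_const (measurable_pi_apply _))
      measurable_const measurable_const

end Threshold

namespace Mechanism

variable (M : Mechanism n₁ n₂)

lemma join_nonneg (θ : Profile n₁ n₂) (i : User n₁ n₂) : 0 ≤ M.join θ i := by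
  rcases M.join_eq θ i with h | h <;> simp [h]

lemma join_le_one (θ : Profile n₁ n₂) (i : User n₁ n₂) : M.join θ i ≤ 1 := by
  rcases M.join_eq θ i with h | h <;> simp [h]

lemma networkValue_nonneg (θ : Profile n₁ n₂) : 0 ≤ M.networkValue θ :=
  Finset.sum_nonneg fun _ _ => M.join_nonneg θ _

lemma networkValue_le (θ : Profile n₁ n₂) : M.networkValue θ ≤ n₁ := by
  refine (Finset.sum_le_card_nsmul Finset.univ (fun j : Fin n₁ => M.join θ (.inl j)) 1
    fun j _ => M.join_le_one θ _).trans_eq ?_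
  simp

lemma measurable_networkValue : Measurable M.networkValue :=
  Finset.measurable_sum _ fun _ _ => M.measurable_join _

lemma measurable_update (i : User n₁ n₂) (s : ℝ) :
    Measurable fun θ : Profile n₁ n₂ => Function.update θ i s :=
  measurable_pi_iff.2 fun j => by
    by_cases h : j = i
    · subst h; simp
    · simpa [h] using measurable_pi_apply j

end Mechanism

lemma integrable_of_bound {F : Profile n₁ n₂ → ℝ} (hF : Measurable F) (C : ℝ)
    (h : ∀ θ, |F θ| ≤ C) : Integrable F (law n₁ n₂) :=
  Integrable.of_bound hF.aestronglyMeasurable C (.of_forall h)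

section Threshold

variable (τ : User n₁ n₂ → ℝ)

local notation "T" => thresholdMechanism n₁ n₂ τ

lemma thresholdMechanism_fee (θ : Profile n₁ n₂) (i : User n₁ n₂) :
    (T).fee θ i = τ i * (T).networkValue θ := rfl

lemma thresholdMechanism_join (θ : Profile n₁ n₂) (i : User n₁ n₂) :
    (T).join θ i = (Set.Ici (τ i)).indicator 1 (θ i) := by
  classical
  simp [thresholdMechanism, Set.indicator_apply]

lemma thresholdMechanism_abs_payment_le (θ : Profile n₁ n₂) (i : User n₁ n₂) :
    |(T).join θ i * (T).fee θ i| ≤ |τ i| * n₁ := by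
  rw [thresholdMechanism_fee, abs_mul, abs_mul, abs_of_nonneg ((T).join_nonneg θ i),
    abs_of_nonneg ((T).networkValue_nonneg θ)]
  calc _ ≤ 1 * (|τ i| * n₁) := by
        gcongr
        · exact mul_nonneg (abs_nonneg _) ((T).networkValue_nonneg θ)
        · exact (T).join_le_one θ i
        · exact (T).networkValue_le θ
    _ = _ := one_mul _

lemma thresholdMechanism_measurable_payment (i : User n₁ n₂) :
    Measurable fun θ => (T).join θ i * (T).fee θ i :=
  ((T).measurable_join i).mul ((T).measurable_fee i)

lemma thresholdMechanism_integrablePayments : (T).IntegrablePayments :=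
  ⟨fun i => integrable_of_bound (thresholdMechanism_measurable_payment τ i) _
    fun θ => thresholdMechanism_abs_payment_le τ θ i,
  fun i s _ => integrable_of_bound
    ((thresholdMechanism_measurable_payment τ i).comp (Mechanism.measurable_update i s)) _
    fun _ => thresholdMechanism_abs_payment_le τ _ i⟩

lemma thresholdMechanism_payoff (i : User n₁ n₂) (t : ℝ) (θ : Profile n₁ n₂) :
    (T).join θ i * (t * (T).networkValue θ - (T).fee θ i) =
      (Set.Ici (τ i)).indicator 1 (θ i) * ((t - τ i) * (T).networkValue θ) := by
  rw [thresholdMechanism_fee, thresholdMechanism_join]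
  ring

lemma thresholdMechanism_individuallyRational : (T).IndividuallyRational := by
  intro i t _
  refine integral_nonneg fun θ => ?_
  simp only [Pi.zero_apply, thresholdMechanism_payoff, Function.update_self]
  by_cases h : t ∈ Set.Ici (τ i)
  · rw [Set.indicator_of_mem h]
    exact mul_nonneg zero_le_one
      (mul_nonneg (sub_nonneg.2 h) ((T).networkValue_nonneg _))
  · simp [Set.indicator_of_notMem h]

lemma thresholdMechanism_join_congr {θ θ' : Profile n₁ n₂}
    (h : ∀ i, θ i ∈ Set.Ici (τ i) ↔ θ' i ∈ Set.Ici (τ i)) (i : User n₁ n₂) :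
    (T).join θ i = (T).join θ' i := by
  classical
  rw [thresholdMechanism_join, thresholdMechanism_join, Set.indicator_apply, Set.indicator_apply]
  exact if_congr (h i) rfl rfl

/-- Truth is optimal pointwise: a report matters only through the side of the threshold it lies on,
and admission is worth `(t - τ i)` times a nonnegative number. -/
lemma thresholdMechanism_incentiveCompatible : (T).IncentiveCompatible := by
  intro i t _ s _
  have hI : ∀ s, Integrable (fun θ => (T).join (Function.update θ i s) i *
      (t * (T).networkValue (Function.update θ i s) - (T).fee (Function.update θ i s) i))
      (law n₁ n₂) := by
    intro s
    simp only [thresholdMechanism_payoff, Function.update_self]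
    refine ((integrable_of_bound ((T).measurable_networkValue.comp
      (Mechanism.measurable_update i s)) n₁ fun θ => ?_).const_mul (t - τ i)).const_mul _
    rw [Function.comp_apply, abs_of_nonneg ((T).networkValue_nonneg _)]
    exact (T).networkValue_le _
  refine integral_mono (hI s) (hI t) fun θ => ?_
  simp only [thresholdMechanism_payoff, Function.update_self]
  by_cases hs : s ∈ Set.Ici (τ i) <;> by_cases ht : t ∈ Set.Ici (τ i)
  · have : ∀ j, Function.update θ i s j ∈ Set.Ici (τ j) ↔
        Function.update θ i t j ∈ Set.Ici (τ j) := by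
      intro j
      by_cases hj : j = i
      · subst hj; simp only [Function.update_self, hs, ht]
      · simp [hj]
    have e : (T).networkValue (Function.update θ i s) = (T).networkValue (Function.update θ i t) :=
      Finset.sum_congr rfl fun j _ => thresholdMechanism_join_congr τ this _
    rw [e, Set.indicator_of_mem hs, Set.indicator_of_mem ht, Pi.one_apply, Pi.one_apply]
  · rw [Set.indicator_of_mem hs, Set.indicator_of_notMem ht, zero_mul, Pi.one_apply, one_mul]
    exact mul_nonpos_of_nonpos_of_nonneg (by
      rw [Set.mem_Ici, not_le] at ht
      linarith) ((T).networkValue_nonneg _)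
  · rw [Set.indicator_of_notMem hs, Set.indicator_of_mem ht, zero_mul, Pi.one_apply, one_mul]
    exact mul_nonneg (sub_nonneg.2 ht) ((T).networkValue_nonneg _)
  · rw [Set.indicator_of_notMem hs, Set.indicator_of_notMem ht, zero_mul, zero_mul]

lemma integral_thresholdMechanism_join (i : User n₁ n₂) (hτ : τ i ∈ Set.Icc (0 : ℝ) 1) :
    ∫ θ, (T).join θ i ∂law n₁ n₂ = 1 - τ i := by
  simp only [thresholdMechanism_join]
  rw [law_eq, integral_comp_eval (μ := fun _ : User n₁ n₂ => unif) (i := i)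
    (f := (Set.Ici (τ i)).indicator (1 : ℝ → ℝ))
    (measurable_one.indicator measurableSet_Ici).aestronglyMeasurable,
    integral_indicator_one measurableSet_Ici, measureReal_restrict_apply measurableSet_Ici]
  have : Set.Ici (τ i) ∩ Set.Icc 0 1 = Set.Icc (τ i) 1 := by
    ext x
    simp only [Set.mem_inter_iff, Set.mem_Ici, Set.mem_Icc]
    exact ⟨fun h => ⟨h.1, h.2.2⟩, fun h => ⟨h.1, hτ.1.trans h.1, h.2⟩⟩
  rw [this, Real.volume_real_Icc_of_le hτ.2]

lemma integrable_join (M : Mechanism n₁ n₂) (i : User n₁ n₂) :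
    Integrable (fun θ => M.join θ i) (law n₁ n₂) :=
  integrable_of_bound (M.measurable_join i) 1 fun θ => by
    rw [abs_of_nonneg (M.join_nonneg θ i)]
    exact M.join_le_one θ i

lemma integral_thresholdMechanism_join_mul {i j : User n₁ n₂} (hij : i ≠ j) :
    ∫ θ, (T).join θ i * (T).join θ j ∂law n₁ n₂ =
      (∫ θ, (T).join θ i ∂law n₁ n₂) * ∫ θ, (T).join θ j ∂law n₁ n₂ := by
  have hind := ProbabilityTheory.iIndepFun_pi (μ := fun _ : User n₁ n₂ => unif)
    (X := fun i => (Set.Ici (τ i)).indicator (1 : ℝ → ℝ))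
    fun i => (measurable_one.indicator measurableSet_Ici).aemeasurable
  have h := (hind.indepFun hij).integral_fun_mul_eq_mul_integral
    (((measurable_one.indicator measurableSet_Ici).comp
      (measurable_pi_apply i)).aestronglyMeasurable)
    (((measurable_one.indicator measurableSet_Ici).comp
      (measurable_pi_apply j)).aestronglyMeasurable)
  simp only [thresholdMechanism_join]
  exact h

lemma integral_thresholdMechanism_networkValue (t₁ t₂ : ℝ) (h : t₁ ∈ Set.Icc (0 : ℝ) 1) :
    ∫ θ, (thresholdMechanism n₁ n₂ (Sum.elim (fun _ => t₁) fun _ => t₂)).networkValue θ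
      ∂law n₁ n₂ = n₁ * (1 - t₁) := by
  unfold Mechanism.networkValue
  rw [integral_finsetSum _ fun j _ => integrable_join _ _]
  rw [Finset.sum_congr rfl fun j _ => integral_thresholdMechanism_join _ _ (by simpa using h)]
  simp
  ring

/-- Posting thresholds yields at least the profit of uniform pricing. -/
lemma uniformProfit_le_expectedProfit (c : ℝ) {t : ℝ × ℝ} (ht : t ∈ thresholds) :
    uniformProfit n₁ n₂ c t ≤ (thresholdMechanism n₁ n₂
      (Sum.elim (fun _ => t.1) fun _ => t.2)).expectedProfit c := by
  have hτ : ∀ i : User n₁ n₂, (Sum.elim (fun _ => t.1) fun _ => t.2 : User n₁ n₂ → ℝ) i ∈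
      Set.Icc (0 : ℝ) 1 := by
    rintro (i | i)
    · exact ht.1
    · exact ht.2
  have hN := integral_thresholdMechanism_networkValue (n₁ := n₁) (n₂ := n₂) t.1 t.2 ht.1
  have hfee := thresholdMechanism_fee (Sum.elim (fun _ => t.1) fun _ => t.2 : User n₁ n₂ → ℝ)
  have hjoin := fun i => integral_thresholdMechanism_join
    (Sum.elim (fun _ => t.1) fun _ => t.2 : User n₁ n₂ → ℝ) i (hτ i)
  have hmul := fun i j => integral_thresholdMechanism_join_mul
    (Sum.elim (fun _ => t.1) fun _ => t.2 : User n₁ n₂ → ℝ) (i := i) (j := j)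
  generalize thresholdMechanism n₁ n₂ (Sum.elim (fun _ => t.1) fun _ => t.2) = M at *
  have hNm := M.measurable_networkValue
  have hNb : ∀ θ, |M.networkValue θ| ≤ n₁ := fun θ => by
    rw [abs_of_nonneg (M.networkValue_nonneg θ)]
    exact M.networkValue_le θ
  have hNi : Integrable M.networkValue (law n₁ n₂) := integrable_of_bound hNm n₁ hNb
  have hN2i : Integrable (fun θ => M.networkValue θ ^ 2) (law n₁ n₂) :=
    integrable_of_bound (hNm.pow_const 2) (n₁ ^ 2) fun θ => by
      rw [abs_pow]
      exact pow_le_pow_left₀ (abs_nonneg _) (hNb θ) 2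
  have hJNi : ∀ i, Integrable (fun θ => M.join θ i * M.networkValue θ) (law n₁ n₂) := fun i =>
    integrable_of_bound ((M.measurable_join i).mul hNm) (1 * n₁) fun θ => by
      rw [abs_mul]
      refine mul_le_mul ?_ (hNb θ) (abs_nonneg _) zero_le_one
      rw [abs_of_nonneg (M.join_nonneg θ i)]
      exact M.join_le_one θ i
  have hJN : ∀ j : Fin n₂, ∫ θ, M.join θ (.inr j) * M.networkValue θ ∂law n₁ n₂ =
      (1 - t.2) * (n₁ * (1 - t.1)) := by
    intro j
    have hji : ∀ k : Fin n₁, Integrable (fun θ => M.join θ (.inr j) * M.join θ (.inl k))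
        (law n₁ n₂) := fun k =>
      integrable_of_bound ((M.measurable_join _).mul (M.measurable_join _)) 1 fun θ => by
        rw [abs_of_nonneg (mul_nonneg (M.join_nonneg _ _) (M.join_nonneg _ _))]
        exact mul_le_one₀ (M.join_le_one _ _) (M.join_nonneg _ _) (M.join_le_one _ _)
    simp only [Mechanism.networkValue, Finset.mul_sum]
    rw [integral_finsetSum _ fun k _ => hji k]
    simp only [hmul (.inr j) (.inl _) (by simp), hjoin]
    simp
    ring
  -- Nonnegativity of the variance. Contributors count themselves, so their revenue involves the
  -- second moment of the network value; this gives an inequality in the favorable direction.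
  have hsq : (n₁ * (1 - t.1)) ^ 2 ≤ ∫ θ, M.networkValue θ ^ 2 ∂law n₁ n₂ := by
    have h0 : 0 ≤ ∫ θ, (M.networkValue θ ^ 2 - 2 * (n₁ * (1 - t.1)) * M.networkValue θ +
        (n₁ * (1 - t.1)) ^ 2) ∂law n₁ n₂ := integral_nonneg fun θ => by
      have := sq_nonneg (M.networkValue θ - n₁ * (1 - t.1))
      simp only [Pi.zero_apply]
      linarith
    have hi : Integrable (fun θ => M.networkValue θ ^ 2 -
        2 * (n₁ * (1 - t.1)) * M.networkValue θ) (law n₁ n₂) := hN2i.sub (hNi.const_mul _)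
    rw [integral_add hi (integrable_const _),
      integral_sub hN2i (hNi.const_mul _), integral_const_mul, hN] at h0
    simp only [integral_const, probReal_univ, one_smul] at h0
    linarith
  have hprofit : ∀ θ, ∑ i, M.join θ i * (M.fee θ i - c) =
      t.1 * M.networkValue θ ^ 2 + t.2 * ∑ j : Fin n₂, M.join θ (.inr j) * M.networkValue θ -
        c * ∑ i, M.join θ i := by
    intro θ
    have e : ∑ i, M.join θ i * (M.fee θ i - c) =
        ∑ i, M.join θ i * M.fee θ i - c * ∑ i, M.join θ i := by
      rw [Finset.mul_sum, ← Finset.sum_sub_distrib]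
      exact Finset.sum_congr rfl fun i _ => by ring
    rw [e, Fintype.sum_sum_type]
    simp only [hfee, Sum.elim_inl, Sum.elim_inr]
    rw [← Finset.sum_mul]
    congr 2
    · change M.networkValue θ * _ = _
      ring
    · rw [Finset.mul_sum]
      exact Finset.sum_congr rfl fun i _ => mul_left_comm _ _ _
  have hsum : Integrable (fun θ => ∑ j : Fin n₂, M.join θ (.inr j) * M.networkValue θ)
      (law n₁ n₂) := integrable_finsetSum _ fun j _ => hJNi _
  have hsumJ : Integrable (fun θ => ∑ i, M.join θ i) (law n₁ n₂) :=
    integrable_finsetSum _ fun j _ => integrable_join M _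
  unfold Mechanism.expectedProfit
  simp only [hprofit]
  have hi : Integrable (fun θ => t.1 * M.networkValue θ ^ 2 +
      t.2 * ∑ j : Fin n₂, M.join θ (.inr j) * M.networkValue θ) (law n₁ n₂) :=
    (hN2i.const_mul _).add (hsum.const_mul _)
  rw [integral_sub hi (hsumJ.const_mul _),
    integral_add (hN2i.const_mul _) (hsum.const_mul _), integral_const_mul, integral_const_mul,
    integral_const_mul, integral_finsetSum _ fun j _ => hJNi _,
    integral_finsetSum _ fun j _ => integrable_join M _]
  simp only [hJN, hjoin, Fintype.sum_sum_type, Sum.elim_inl, Sum.elim_inr, Finset.sum_const,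
    Finset.card_univ, Fintype.card_fin, nsmul_eq_mul]
  have := mul_le_mul_of_nonneg_left hsq ht.1.1
  unfold uniformProfit uniformPrice₁ uniformPrice₂
  linarith

end Threshold

/-! ### The envelope formula -/

/-- A function with bounded subgradients `q` on `[0,1]` is recovered from them. -/
lemma integral_one_sub_mul_subgradient {U q : ℝ → ℝ} {K : ℝ}
    (h : ∀ t ∈ Set.Icc (0 : ℝ) 1, ∀ s ∈ Set.Icc (0 : ℝ) 1, U s + (t - s) * q s ≤ U t)
    (hK : ∀ s ∈ Set.Icc (0 : ℝ) 1, |q s| ≤ K) :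
    ContinuousOn U (Set.Icc 0 1) ∧
      ∫ s in (0 : ℝ)..1, (1 - s) * q s = (∫ s in (0 : ℝ)..1, U s) - U 0 := by
  have hK0 : 0 ≤ K := (abs_nonneg _).trans (hK 0 (by simp))
  have hsub : ∀ t ∈ Set.Icc (0 : ℝ) 1, ∀ s ∈ Set.Icc (0 : ℝ) 1, U s - U t ≤ K * |s - t| := by
    intro t ht s hs
    have h1 := h t ht s hs
    have h2 : -((t - s) * q s) ≤ |t - s| * |q s| := (neg_le_abs _).trans (abs_mul _ _).le
    have h3 : |t - s| * |q s| ≤ |t - s| * K := by gcongr; exact hK s hs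
    rw [abs_sub_comm s t]
    linarith
  -- Bounded subgradients make `U` Lipschitz, hence absolutely continuous, which permits integration
  -- by parts with no regularity assumed of `q`.
  have hLip : LipschitzOnWith K.toNNReal U (Set.uIcc 0 1) := by
    rw [Set.uIcc_of_le zero_le_one]
    refine LipschitzOnWith.of_dist_le_mul fun s hs t ht => ?_
    rw [Real.dist_eq, Real.dist_eq, abs_le, Real.coe_toNNReal _ hK0]
    have h1 := hsub t ht s hs
    have h2 := hsub s hs t ht
    rw [abs_sub_comm] at h2
    exact ⟨by linarith, h1⟩
  have hU := hLip.absolutelyContinuousOnInterval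
  have hg : AbsolutelyContinuousOnInterval (fun s : ℝ => 1 - s) 0 1 :=
    (contDiff_const.sub contDiff_id).contDiffOn.absolutelyContinuousOnInterval
  refine ⟨by simpa [Set.uIcc_of_le] using hU.continuousOn, ?_⟩
  have hparts := AbsolutelyContinuousOnInterval.integral_mul_deriv_eq_deriv_mul hg hU
  have hd : ∀ x : ℝ, deriv (fun s : ℝ => 1 - s) x = -1 := fun x => by
    simp
  simp only [hd, neg_one_mul, intervalIntegral.integral_neg] at hparts
  have hae : ∫ s in (0 : ℝ)..1, (1 - s) * q s = ∫ s in (0 : ℝ)..1, (1 - s) * deriv U s := by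
    apply intervalIntegral.integral_congr_ae
    have h1 : ∀ᵐ x : ℝ, x ≠ 1 := by simp [ae_iff]
    filter_upwards [hU.ae_differentiableAt, h1] with x hx hx1 hx'
    rw [Set.uIoc_of_le zero_le_one] at hx'
    have hxI : x ∈ Set.Ioo (0 : ℝ) 1 := ⟨hx'.1, lt_of_le_of_ne hx'.2 hx1⟩
    have hx2 := (hx (by
      rw [Set.uIcc_of_le zero_le_one]
      exact Set.Ioo_subset_Icc_self hxI)).hasDerivAt
    -- The subgradient inequality says that `U t - t * q x` is minimal at `t = x`; so `U' = q`
    -- wherever `U` is differentiable.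
    have hmin : IsLocalMin (fun t => U t - t * q x) x := by
      filter_upwards [Ioo_mem_nhds hxI.1 hxI.2] with t ht
      have := h t (Set.Ioo_subset_Icc_self ht) x (Set.Ioo_subset_Icc_self hxI)
      linarith
    have := hmin.hasDerivAt_eq_zero (hx2.sub ((hasDerivAt_id x).mul_const (q x)))
    rw [one_mul, sub_eq_zero] at this
    rw [this]
  rw [hae, hparts]
  ring

/-! ### Greatest virtual valuations -/

lemma virtualValue_eq (t : ℝ) : virtualValue t = 2 * t - 1 := by
  rw [virtualValue]; ring

section TopSum

variable {n : ℕ} (v : Fin n → ℝ)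

/-- The users with the `m` greatest valuations. -/
noncomputable def topUsers (m : ℕ) : Finset (Fin n) :=
  (Finset.univ.filter fun i : Fin n => i.val < m).map (Tuple.sort fun j => -v j).toEmbedding

lemma topVirtualSum_eq (m : ℕ) : topVirtualSum m v = ∑ i ∈ topUsers v m, virtualValue (v i) := by
  rw [topVirtualSum, topUsers, Finset.sum_map]
  rfl

lemma card_topUsers {m : ℕ} (hm : m ≤ n) : (topUsers v m).card = m := by
  rw [topUsers, Finset.card_map, Fin.card_filter_val_lt, min_eq_right hm]

lemma sort_antitone : Antitone (v ∘ Tuple.sort fun j => -v j) := by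
  intro i j hij
  have := Tuple.monotone_sort (fun j => -v j) hij
  simpa using this

/-- Subtract the cutoff `z`, the smallest virtual value among the top users. The sum of all positive
parts then bounds any selection and is attained by the top users. -/
lemma sum_le_topVirtualSum (A : Finset (Fin n)) :
    ∑ i ∈ A, virtualValue (v i) ≤ topVirtualSum A.card v := by
  rcases A.eq_empty_or_nonempty with rfl | hA
  · simp [topVirtualSum]
  have hcard : A.card ≤ n := by simpa using Finset.card_le_univ A
  have hpos : 0 < A.card := hA.card_pos
  set σ := Tuple.sort fun j => -v j with hσ
  set z := virtualValue (v (σ ⟨A.card - 1, by omega⟩)) with hz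
  have hanti := sort_antitone v
  have hmem : ∀ i, i ∈ topUsers v A.card ↔ (σ.symm i).val < A.card := by
    intro i
    simp [topUsers, ← hσ]
  have hin : ∀ i ∈ topUsers v A.card, z ≤ virtualValue (v i) := by
    intro i hi
    have h1 := (hmem i).1 hi
    have h2 := hanti (a := σ.symm i) (b := ⟨A.card - 1, by omega⟩) (by
      rw [Fin.le_def]
      simp only
      omega)
    simp only [Function.comp_apply, ← hσ, Equiv.apply_symm_apply] at h2
    rw [hz, virtualValue_eq, virtualValue_eq]
    linarith
  have hout : ∀ i, i ∉ topUsers v A.card → virtualValue (v i) ≤ z := by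
    intro i hi
    have h1 := mt (hmem i).2 hi
    have h2 := hanti (a := ⟨A.card - 1, by omega⟩) (b := σ.symm i) (by
      rw [Fin.le_def]
      simp only
      omega)
    simp only [Function.comp_apply, ← hσ, Equiv.apply_symm_apply] at h2
    rw [hz, virtualValue_eq, virtualValue_eq]
    linarith
  rw [topVirtualSum_eq]
  have key : ∑ i ∈ A, (virtualValue (v i) - z) ≤
      ∑ i ∈ topUsers v A.card, (virtualValue (v i) - z) := by
    calc ∑ i ∈ A, (virtualValue (v i) - z) ≤ ∑ i ∈ A, max (virtualValue (v i) - z) 0 :=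
          Finset.sum_le_sum fun i _ => le_max_left _ _
      _ ≤ ∑ i, max (virtualValue (v i) - z) 0 :=
          Finset.sum_le_sum_of_subset_of_nonneg (Finset.subset_univ _) fun i _ _ => le_max_right _ _
      _ = ∑ i ∈ topUsers v A.card, max (virtualValue (v i) - z) 0 := by
          symm
          refine Finset.sum_subset (Finset.subset_univ _) fun i _ hi => ?_
          exact max_eq_right (sub_nonpos.2 (hout i hi))
      _ = _ := Finset.sum_congr rfl fun i hi => max_eq_left (sub_nonneg.2 (hin i hi))
  rw [Finset.sum_sub_distrib, Finset.sum_sub_distrib, Finset.sum_const, Finset.sum_const,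
    card_topUsers v hcard] at key
  linarith

/-- A threshold `τ` bounds the sum of the `m` greatest virtual valuations. -/
lemma topVirtualSum_le {m : ℕ} (hm : m ≤ n) (τ : ℝ) :
    topVirtualSum m v ≤ ∑ i, max (2 * (v i - τ)) 0 + m * (2 * τ - 1) := by
  rw [topVirtualSum_eq]
  calc ∑ i ∈ topUsers v m, virtualValue (v i)
      ≤ ∑ i ∈ topUsers v m, (max (2 * (v i - τ)) 0 + (2 * τ - 1)) := by
        refine Finset.sum_le_sum fun i _ => ?_
        rw [virtualValue_eq]
        linarith [le_max_left (2 * (v i - τ)) 0]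
    _ = ∑ i ∈ topUsers v m, max (2 * (v i - τ)) 0 + m * (2 * τ - 1) := by
        rw [Finset.sum_add_distrib, Finset.sum_const, card_topUsers v hm, nsmul_eq_mul]
    _ ≤ ∑ i, max (2 * (v i - τ)) 0 + m * (2 * τ - 1) := by
        have := Finset.sum_le_sum_of_subset_of_nonneg (Finset.subset_univ (topUsers v m))
          (f := fun i => max (2 * (v i - τ)) 0) fun i _ _ => le_max_right _ _
        linarith

/-- This form avoids the sorting permutation and makes measurability in `v` immediate. -/
lemma topVirtualSum_eq_sup' {m : ℕ} (hm : m ≤ n) :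
    topVirtualSum m v = (Finset.powersetCard m Finset.univ).sup'
      (Finset.powersetCard_nonempty.2 (by simpa using hm))
      fun A => ∑ i ∈ A, virtualValue (v i) := by
  apply le_antisymm
  · rw [topVirtualSum_eq]
    exact Finset.le_sup' (fun A => ∑ i ∈ A, virtualValue (v i))
      (Finset.mem_powersetCard.2 ⟨Finset.subset_univ _, card_topUsers v hm⟩)
  · refine Finset.sup'_le _ _ fun A hA => ?_
    simpa only [(Finset.mem_powersetCard.1 hA).2] using sum_le_topVirtualSum v A

lemma measurable_topVirtualSum {m : ℕ} (hm : m ≤ n) :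
    Measurable fun v : Fin n → ℝ => topVirtualSum m v := by
  simp_rw [topVirtualSum_eq_sup' _ hm]
  have hne : (Finset.powersetCard m (Finset.univ : Finset (Fin n))).Nonempty :=
    Finset.powersetCard_nonempty.2 (by simpa using hm)
  have := Finset.measurable_sup' hne (f := fun (A : Finset (Fin n)) (v : Fin n → ℝ) =>
    ∑ i ∈ A, virtualValue (v i)) fun A _ => Finset.measurable_sum A fun i _ => by
      simp only [virtualValue_eq]
      fun_prop
  convert this using 1
  ext v
  rw [Finset.sup'_apply]

end TopSum

/-! ### Virtual surplus -/

section Surplus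

variable {n₁ n₂ : ℕ} {c : ℝ}

/-- The virtual surplus when the best `m₁` contributors and the best `m₂` pure users join. -/
noncomputable def virtualSurplus (c : ℝ) (m : Fin (n₁ + 1) × Fin (n₂ + 1))
    (θ : Profile n₁ n₂) : ℝ :=
  (m.1.val : ℝ) * (topVirtualSum m.1.val (fun i : Fin n₁ => θ (Sum.inl i)) +
    topVirtualSum m.2.val (fun i : Fin n₂ => θ (Sum.inr i))) - ((m.1.val : ℝ) + m.2.val) * c

/-- The maximal virtual surplus. -/
noncomputable def maxVirtualSurplus (c : ℝ) (θ : Profile n₁ n₂) : ℝ :=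
  ⨆ m : Fin (n₁ + 1) × Fin (n₂ + 1), virtualSurplus c m θ

lemma virtualProfit_eq (n₁ n₂ : ℕ) (c : ℝ) :
    virtualProfit n₁ n₂ c = ∫ θ, maxVirtualSurplus c θ ∂law n₁ n₂ := rfl

lemma virtualSurplus_le_max (m : Fin (n₁ + 1) × Fin (n₂ + 1)) (θ : Profile n₁ n₂) :
    virtualSurplus c m θ ≤ maxVirtualSurplus c θ :=
  le_ciSup (f := fun m => virtualSurplus c m θ) (Set.finite_range _).bddAbove m

lemma measurable_maxVirtualSurplus : Measurable (maxVirtualSurplus (n₁ := n₁) (n₂ := n₂) c) := by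
  refine Measurable.iSup fun m => ?_
  have e1 : Measurable fun (θ : Profile n₁ n₂) (i : Fin n₁) => θ (Sum.inl i) := by fun_prop
  have e2 : Measurable fun (θ : Profile n₁ n₂) (i : Fin n₂) => θ (Sum.inr i) := by fun_prop
  have h1 := (measurable_topVirtualSum (n := n₁) (m := m.1.val) (by omega)).comp e1
  have h2 := (measurable_topVirtualSum (n := n₂) (m := m.2.val) (by omega)).comp e2
  exact ((h1.add h2).const_mul _).sub_const _

lemma maxVirtualSurplus_nonneg (θ : Profile n₁ n₂) : 0 ≤ maxVirtualSurplus c θ := by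
  have := virtualSurplus_le_max (c := c) 0 θ
  simpa [virtualSurplus] using this

lemma sum_max_le {n : ℕ} {v : Fin n → ℝ} (hv : ∀ i, v i ≤ 1) :
    ∑ i, max (2 * (v i - 0)) 0 ≤ 2 * n := by
  have := Finset.sum_le_card_nsmul Finset.univ (fun i => max (2 * (v i - 0)) 0) 2
    fun i _ => max_le (by linarith [hv i]) (by norm_num)
  simpa [mul_comm] using this

/-- A crude bound from threshold `0`, needed only for integrability. -/
lemma maxVirtualSurplus_le (hc : 0 ≤ c) {θ : Profile n₁ n₂}
    (hθ : ∀ i, θ i ∈ Set.Icc (0 : ℝ) 1) : maxVirtualSurplus c θ ≤ n₁ * (2 * n₁ + 2 * n₂) := by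
  refine ciSup_le fun m => ?_
  have h1 := topVirtualSum_le (fun i : Fin n₁ => θ (Sum.inl i)) (m := m.1.val) (by omega) 0
  have h2 := topVirtualSum_le (fun i : Fin n₂ => θ (Sum.inr i)) (m := m.2.val) (by omega) 0
  have h3 := sum_max_le fun i : Fin n₁ => (hθ (.inl i)).2
  have h4 := sum_max_le fun i : Fin n₂ => (hθ (.inr i)).2
  have hm1 : (m.1.val : ℝ) ≤ n₁ := by exact_mod_cast Nat.lt_succ_iff.1 m.1.2
  have h5 : 0 ≤ ((m.1.val : ℝ) + m.2.val) * c := by positivity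
  have h6 : (0 : ℝ) ≤ m.1.val := by positivity
  have h7 : (0 : ℝ) ≤ m.2.val := by positivity
  calc virtualSurplus c m θ ≤ m.1.val * (2 * n₁ + 2 * n₂) := by
        rw [virtualSurplus]
        have := mul_le_mul_of_nonneg_left (by linarith : topVirtualSum m.1.val
          (fun i : Fin n₁ => θ (Sum.inl i)) + topVirtualSum m.2.val
          (fun i : Fin n₂ => θ (Sum.inr i)) ≤ 2 * n₁ + 2 * n₂) h6
        linarith
    _ ≤ _ := by gcongr

lemma integrable_maxVirtualSurplus (hc : 0 ≤ c) :
    Integrable (maxVirtualSurplus (n₁ := n₁) (n₂ := n₂) c) (law n₁ n₂) := by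
  refine Integrable.of_bound measurable_maxVirtualSurplus.aestronglyMeasurable
    (n₁ * (2 * n₁ + 2 * n₂)) ?_
  filter_upwards [ae_mem_Icc n₁ n₂] with θ hθ
  rw [Real.norm_of_nonneg (maxVirtualSurplus_nonneg θ)]
  exact maxVirtualSurplus_le hc hθ

namespace Mechanism

variable (M : Mechanism n₁ n₂)

/-- The virtual surplus of every scheme is at most the maximal one. -/
lemma sum_join_virtual_le (c : ℝ) (θ : Profile n₁ n₂) :
    ∑ i, M.join θ i * (virtualValue (θ i) * M.networkValue θ - c) ≤ maxVirtualSurplus c θ := by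
  classical
  have hsum : ∀ {n : ℕ} (ι : Fin n → User n₁ n₂) (f : Fin n → ℝ),
      ∑ i, M.join θ (ι i) * f i = ∑ i with M.join θ (ι i) = 1, f i := by
    intro n ι f
    rw [Finset.sum_filter]
    refine Finset.sum_congr rfl fun i _ => ?_
    rcases M.join_eq θ (ι i) with h | h <;> simp [h]
  set A : Finset (Fin n₁) := {i | M.join θ (.inl i) = 1} with hA
  set B : Finset (Fin n₂) := {i | M.join θ (.inr i) = 1} with hB
  have hcA : A.card < n₁ + 1 := by
    rw [Nat.lt_succ_iff]
    simpa using Finset.card_le_univ A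
  have hcB : B.card < n₂ + 1 := by
    rw [Nat.lt_succ_iff]
    simpa using Finset.card_le_univ B
  have hN : M.networkValue θ = A.card := by
    have := hsum Sum.inl fun _ => 1
    simpa [Mechanism.networkValue] using this
  refine le_trans ?_ (virtualSurplus_le_max (c := c) (⟨A.card, hcA⟩, ⟨B.card, hcB⟩) θ)
  rw [Fintype.sum_sum_type, hsum Sum.inl fun i => virtualValue (θ (.inl i)) * M.networkValue θ - c,
    hsum Sum.inr fun i => virtualValue (θ (.inr i)) * M.networkValue θ - c, ← hA, ← hB,
    Finset.sum_sub_distrib, Finset.sum_sub_distrib, ← Finset.sum_mul, ← Finset.sum_mul,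
    Finset.sum_const, Finset.sum_const, virtualSurplus, hN]
  simp only [nsmul_eq_mul]
  have h1 := sum_le_topVirtualSum (fun i : Fin n₁ => θ (.inl i)) A
  have h2 := sum_le_topVirtualSum (fun i : Fin n₂ => θ (.inr i)) B
  have h3 := mul_le_mul_of_nonneg_left (add_le_add h1 h2) (Nat.cast_nonneg (α := ℝ) A.card)
  linarith

lemma abs_join_mul_networkValue_le (θ : Profile n₁ n₂) (i : User n₁ n₂) :
    |M.join θ i * M.networkValue θ| ≤ n₁ := by
  rw [abs_of_nonneg (mul_nonneg (M.join_nonneg θ i) (M.networkValue_nonneg θ))]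
  calc _ ≤ 1 * (n₁ : ℝ) := mul_le_mul (M.join_le_one θ i) (M.networkValue_le θ)
        (M.networkValue_nonneg θ) zero_le_one
    _ = _ := one_mul _

lemma measurable_join_mul_networkValue (i : User n₁ n₂) :
    Measurable fun θ => M.join θ i * M.networkValue θ :=
  (M.measurable_join i).mul M.measurable_networkValue

/-- The expected network value of user `i` who reports `s`. -/
noncomputable def interimValue (i : User n₁ n₂) (s : ℝ) : ℝ :=
  ∫ θ, M.join (Function.update θ i s) i * M.networkValue (Function.update θ i s) ∂law n₁ n₂

/-- The expected payment of user `i` who reports `s`. -/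
noncomputable def interimPayment (i : User n₁ n₂) (s : ℝ) : ℝ :=
  ∫ θ, M.join (Function.update θ i s) i * M.fee (Function.update θ i s) i ∂law n₁ n₂

lemma abs_interimValue_le (i : User n₁ n₂) (s : ℝ) : |M.interimValue i s| ≤ n₁ := by
  have := norm_integral_le_of_norm_le_const (μ := law n₁ n₂) (C := n₁)
    (f := fun θ => M.join (Function.update θ i s) i * M.networkValue (Function.update θ i s))
    (.of_forall fun θ => M.abs_join_mul_networkValue_le (Function.update θ i s) i)
  simpa [interimValue] using this

variable {M}

lemma interimPayoff_eq (hI : M.IntegrablePayments) (i : User n₁ n₂) (t : ℝ) {s : ℝ}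
    (hs : s ∈ Set.Icc (0 : ℝ) 1) :
    M.interimPayoff i t s = t * M.interimValue i s - M.interimPayment i s := by
  have h1 : Integrable (fun θ => M.join (Function.update θ i s) i *
      M.networkValue (Function.update θ i s)) (law n₁ n₂) :=
    integrable_of_bound ((M.measurable_join_mul_networkValue i).comp (measurable_update i s)) n₁
      fun θ => M.abs_join_mul_networkValue_le _ i
  rw [interimValue, interimPayment, ← integral_const_mul,
    ← integral_sub (h1.const_mul t) (hI.2 i s hs), interimPayoff]
  congr 1
  ext θ
  ring

lemma integrable_virtual (M : Mechanism n₁ n₂) (i : User n₁ n₂) :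
    Integrable (fun θ => M.join θ i * (virtualValue (θ i) * M.networkValue θ)) (law n₁ n₂) := by
  refine Integrable.of_bound (C := n₁) ?_ ?_
  · refine Measurable.aestronglyMeasurable
      ((M.measurable_join i).mul (Measurable.mul ?_ M.measurable_networkValue))
    simp only [virtualValue_eq]
    fun_prop
  · filter_upwards [ae_mem_Icc n₁ n₂] with θ hθ
    have e : M.join θ i * (virtualValue (θ i) * M.networkValue θ) =
      virtualValue (θ i) * (M.join θ i * M.networkValue θ) := by ring
    rw [e, Real.norm_eq_abs, abs_mul]
    have h1 : |virtualValue (θ i)| ≤ 1 := by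
      obtain ⟨h0, h1⟩ := hθ i
      rw [virtualValue_eq, abs_le]
      constructor <;> linarith
    calc _ ≤ 1 * (n₁ : ℝ) :=
          mul_le_mul h1 (M.abs_join_mul_networkValue_le θ i) (abs_nonneg _) zero_le_one
      _ = _ := one_mul _

/-- The expected payment of a user is at most the expected virtual valuation of the network. -/
lemma expected_payment_le (hI : M.IntegrablePayments) (hIR : M.IndividuallyRational)
    (hIC : M.IncentiveCompatible) (i : User n₁ n₂) :
    ∫ θ, M.join θ i * M.fee θ i ∂law n₁ n₂ ≤
      ∫ θ, M.join θ i * (virtualValue (θ i) * M.networkValue θ) ∂law n₁ n₂ := by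
  obtain ⟨hpi, hp⟩ := integral_law_eq i (hI.1 i)
  obtain ⟨hvi, hv⟩ := integral_law_eq i (M.integrable_virtual i)
  have hv' : ∀ s, ∫ θ, M.join (Function.update θ i s) i *
      (virtualValue (Function.update θ i s i) * M.networkValue (Function.update θ i s))
      ∂law n₁ n₂ = (2 * s - 1) * M.interimValue i s := by
    intro s
    rw [interimValue, ← integral_const_mul]
    congr 1
    ext θ
    rw [Function.update_self, virtualValue_eq]
    ring
  simp only [hv'] at hvi hv
  rw [hp, hv]
  change ∫ s, M.interimPayment i s ∂unif ≤ _
  change Integrable (fun s => M.interimPayment i s) unif at hpi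
  -- Incentive compatibility says exactly that the interim value is a subgradient of the truthful
  -- payoff.
  obtain ⟨hcont, henv⟩ := integral_one_sub_mul_subgradient
    (U := fun t => M.interimPayoff i t t) (q := M.interimValue i) (K := n₁) (by
      intro t ht s hs
      have := hIC i t ht s hs
      rw [interimPayoff_eq hI i t hs] at this
      simp only [interimPayoff_eq hI i s hs]
      linarith) fun s _ => M.abs_interimValue_le i s
  have hUi : Integrable (fun t => M.interimPayoff i t t) unif := hcont.integrableOn_Icc
  have h0 := hIR i 0 (by simp)
  have hUe : ∀ᵐ s ∂unif, M.interimPayoff i s s + M.interimPayment i s = s * M.interimValue i s := by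
    filter_upwards [ae_restrict_mem measurableSet_Icc] with s hs
    rw [interimPayoff_eq hI i s hs]
    ring
  have hsq : Integrable (fun s => s * M.interimValue i s) unif :=
    (hUi.add hpi).congr hUe
  have h2 : ∫ s, M.interimPayoff i s s ∂unif + ∫ s, M.interimPayment i s ∂unif =
      ∫ s, s * M.interimValue i s ∂unif := by
    rw [← integral_add hUi hpi]
    exact integral_congr_ae hUe
  -- The information rent: `1 - s` is the valuation `s` minus the virtual value `2s - 1`. Expected
  -- payment is therefore expected virtual value minus the payoff at `0`, which is nonnegative.
  have h3 : ∫ s, (1 - s) * M.interimValue i s ∂unif =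
      ∫ s, s * M.interimValue i s ∂unif - ∫ s, (2 * s - 1) * M.interimValue i s ∂unif := by
    rw [← integral_sub hsq hvi]
    congr 1
    ext s
    ring
  rw [← integral_unif, ← integral_unif, h3] at henv
  linarith

lemma expectedProfit_le_virtualProfit {c : ℝ} (hc : 0 ≤ c) (hI : M.IntegrablePayments)
    (hIR : M.IndividuallyRational) (hIC : M.IncentiveCompatible) :
    M.expectedProfit c ≤ virtualProfit n₁ n₂ c := by
  have hj : ∀ i, Integrable (fun θ => M.join θ i * c) (law n₁ n₂) := fun i =>
    (integrable_join M i).mul_const c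
  have hf : ∀ i, Integrable (fun θ => M.join θ i * M.fee θ i - M.join θ i * c) (law n₁ n₂) :=
    fun i => (hI.1 i).sub (hj i)
  have hg : ∀ i, Integrable (fun θ => M.join θ i * (virtualValue (θ i) * M.networkValue θ) -
      M.join θ i * c) (law n₁ n₂) := fun i => (M.integrable_virtual i).sub (hj i)
  rw [expectedProfit, virtualProfit_eq]
  calc ∫ θ, ∑ i, M.join θ i * (M.fee θ i - c) ∂law n₁ n₂
      = ∑ i, (∫ θ, M.join θ i * M.fee θ i ∂law n₁ n₂ - ∫ θ, M.join θ i * c ∂law n₁ n₂) := by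
        simp only [mul_sub]
        rw [integral_finsetSum _ fun i _ => hf i]
        exact Finset.sum_congr rfl fun i _ => integral_sub (hI.1 i) (hj i)
    _ ≤ ∑ i, (∫ θ, M.join θ i * (virtualValue (θ i) * M.networkValue θ) ∂law n₁ n₂ -
          ∫ θ, M.join θ i * c ∂law n₁ n₂) :=
        Finset.sum_le_sum fun i _ => sub_le_sub_right (expected_payment_le hI hIR hIC i) _
    _ = ∫ θ, ∑ i, M.join θ i * (virtualValue (θ i) * M.networkValue θ - c) ∂law n₁ n₂ := by
        simp only [mul_sub]
        rw [integral_finsetSum _ fun i _ => hg i]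
        exact Finset.sum_congr rfl fun i _ => (integral_sub (M.integrable_virtual i) (hj i)).symm
    _ ≤ _ := by
        refine integral_mono ?_ (integrable_maxVirtualSurplus hc) (M.sum_join_virtual_le c)
        simp only [mul_sub]
        exact integrable_finsetSum _ fun i _ => hg i

end Mechanism

lemma profitD_le_virtualProfit (hc : 0 ≤ c) : profitD n₁ n₂ c ≤ virtualProfit n₁ n₂ c := by
  refine csSup_le ⟨_, thresholdMechanism n₁ n₂ 0, thresholdMechanism_integrablePayments _,
    thresholdMechanism_individuallyRational _, thresholdMechanism_incentiveCompatible _, rfl⟩ ?_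
  rintro _ ⟨M, hI, hIR, hIC, rfl⟩
  exact M.expectedProfit_le_virtualProfit hc hI hIR hIC

lemma profitU_le_profitD (hc : 0 ≤ c) : profitU n₁ n₂ c ≤ profitD n₁ n₂ c := by
  obtain ⟨t, ht, hmax⟩ := exists_isMaxOn_uniformProfit n₁ n₂ c
  rw [profitU_eq_of_isMaxOn ht hmax]
  -- The virtual profit also serves as the upper bound without which the supremum would default to
  -- `0`.
  refine (uniformProfit_le_expectedProfit c ht).trans (le_csSup ⟨virtualProfit n₁ n₂ c, ?_⟩
    ⟨_, thresholdMechanism_integrablePayments _, thresholdMechanism_individuallyRational _,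
      thresholdMechanism_incentiveCompatible _, rfl⟩)
  rintro _ ⟨M, hI, hIR, hIC, rfl⟩
  exact M.expectedProfit_le_virtualProfit hc hI hIR hIC

end Surplus

/-! ### Concentration of the virtual surplus -/

section Concentration

variable {n₁ n₂ : ℕ} {c : ℝ}

/-- The part of twice the valuation above the threshold `τ`. -/
noncomputable def excess (τ t : ℝ) : ℝ := max (2 * (t - τ)) 0

lemma integral_excess {τ : ℝ} (hτ : τ ∈ Set.Icc (0 : ℝ) 1) :
    ∫ t, excess τ t ∂unif = (1 - τ) ^ 2 := by
  have hc : Continuous (excess τ) := by unfold excess; fun_prop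
  rw [integral_unif, ← intervalIntegral.integral_add_adjacent_intervals
    (hc.intervalIntegrable 0 τ) (hc.intervalIntegrable τ 1)]
  have h1 : ∫ t in (0 : ℝ)..τ, excess τ t = ∫ t in (0 : ℝ)..τ, (0 : ℝ) := by
    refine intervalIntegral.integral_congr fun t ht => ?_
    rw [Set.uIcc_of_le hτ.1] at ht
    exact max_eq_right (by linarith [ht.2])
  have h2 : ∫ t in τ..1, excess τ t = ∫ t in τ..1, 2 * (t - τ) := by
    refine intervalIntegral.integral_congr fun t ht => ?_
    rw [Set.uIcc_of_le hτ.2] at ht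
    exact max_eq_left (by linarith [ht.1])
  rw [h1, h2, intervalIntegral.integral_zero, intervalIntegral.integral_const_mul,
    intervalIntegral.integral_sub (by simp) (by simp), integral_id, intervalIntegral.integral_const,
    smul_eq_mul]
  ring

lemma excess_mem_Icc {τ t : ℝ} (hτ : 0 ≤ τ) (ht : t ≤ 1) : excess τ t ∈ Set.Icc (0 : ℝ) 2 :=
  ⟨le_max_right _ _, max_le (by linarith) (by norm_num)⟩

lemma ae_excess_mem_Icc {τ : ℝ} (hτ : 0 ≤ τ) : ∀ᵐ t ∂unif, excess τ t ∈ Set.Icc (0 : ℝ) 2 := by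
  filter_upwards [ae_restrict_mem measurableSet_Icc] with t ht
  exact excess_mem_Icc hτ ht.2

lemma measurable_excess (τ : ℝ) : Measurable (excess τ) := by
  unfold excess; fun_prop

lemma memLp_excess {τ : ℝ} (hτ : 0 ≤ τ) : MemLp (excess τ) 2 unif :=
  memLp_of_bounded (ae_excess_mem_Icc hτ) (measurable_excess τ).aestronglyMeasurable 2

/-- The total excess over type-dependent thresholds. -/
noncomputable def totalExcess (τ : User n₁ n₂ → ℝ) : Profile n₁ n₂ → ℝ :=
  ∑ i, fun θ => excess (τ i) (θ i)

lemma totalExcess_apply (τ : User n₁ n₂ → ℝ) (θ : Profile n₁ n₂) :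
    totalExcess τ θ = ∑ i, excess (τ i) (θ i) := by
  simp [totalExcess]

variable {τ : User n₁ n₂ → ℝ}

lemma memLp_totalExcess (hτ : ∀ i, τ i ∈ Set.Icc (0 : ℝ) 1) :
    MemLp (totalExcess τ) 2 (law n₁ n₂) :=
  memLp_finsetSum' _ fun i _ => (memLp_excess (hτ i).1).comp_measurePreserving
    (measurePreserving_eval (fun _ : User n₁ n₂ => unif) i)

lemma integral_totalExcess (hτ : ∀ i, τ i ∈ Set.Icc (0 : ℝ) 1) :
    ∫ θ, totalExcess τ θ ∂law n₁ n₂ = ∑ i, (1 - τ i) ^ 2 := by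
  simp only [totalExcess_apply]
  rw [integral_finsetSum _ fun i _ => ?_]
  · refine Finset.sum_congr rfl fun i _ => ?_
    rw [law_eq, integral_comp_eval (μ := fun _ : User n₁ n₂ => unif) (i := i)
      (measurable_excess (τ i)).aestronglyMeasurable, integral_excess (hτ i)]
  · exact integrable_comp_eval (μ := fun _ : User n₁ n₂ => unif)
      ((memLp_excess (hτ i).1).integrable one_le_two)

lemma variance_totalExcess_le (hτ : ∀ i, τ i ∈ Set.Icc (0 : ℝ) 1) :
    ProbabilityTheory.variance (totalExcess τ) (law n₁ n₂) ≤ n₁ + n₂ := by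
  have h := ProbabilityTheory.variance_sum_pi (μ := fun _ : User n₁ n₂ => unif)
    (X := fun i => excess (τ i)) fun i => memLp_excess (hτ i).1
  rw [totalExcess, law_eq, h]
  -- A variable with values in `[0,2]` has variance at most `1`.
  calc _ ≤ ∑ _i : User n₁ n₂, ((2 - 0) / 2 : ℝ) ^ 2 :=
        Finset.sum_le_sum fun i _ => ProbabilityTheory.variance_le_sq_of_bounded
          (ae_excess_mem_Icc (hτ i).1) (measurable_excess (τ i)).aemeasurable
    _ = _ := by simp

lemma integral_abs_totalExcess_sub_le (hτ : ∀ i, τ i ∈ Set.Icc (0 : ℝ) 1) :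
    ∫ θ, |totalExcess τ θ - ∑ i, (1 - τ i) ^ 2| ∂law n₁ n₂ ≤ √(n₁ + n₂) := by
  have hL := memLp_totalExcess hτ
  have hLs : MemLp (fun θ => totalExcess τ θ - ∑ i, (1 - τ i) ^ 2) 2 (law n₁ n₂) :=
    hL.sub (memLp_const _)
  have hvar := variance_totalExcess_le hτ
  rw [ProbabilityTheory.variance_eq_integral hL.aemeasurable, integral_totalExcess hτ] at hvar
  refine Real.le_sqrt_of_sq_le (le_trans ?_ hvar)
  -- `(E|X|)² ≤ E X²`, as nonnegativity of the variance of `|X|`.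
  have hv := ProbabilityTheory.variance_nonneg
    (fun θ => |totalExcess τ θ - ∑ i, (1 - τ i) ^ 2|) (law n₁ n₂)
  have hLa : MemLp (fun θ => |totalExcess τ θ - ∑ i, (1 - τ i) ^ 2|) 2 (law n₁ n₂) := hLs.abs
  rw [ProbabilityTheory.variance_eq_sub hLa] at hv
  simpa using hv

/-- The maximal virtual surplus is governed by the total excess over the thresholds that are
optimal in the limit. -/
lemma maxVirtualSurplus_le_excess (hc : 0 ≤ c) (h₁ : 0 < n₁) (h₂ : 0 < n₂) (θ : Profile n₁ n₂) :
    maxVirtualSurplus c θ ≤ profitFormula n₁ n₂ + n₁ * |totalExcess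
      (Sum.elim (fun _ => 1 - optimalShare n₁ n₂) fun _ => 1 / 2 : User n₁ n₂ → ℝ) θ -
        (n₁ * optimalShare n₁ n₂ ^ 2 + n₂ / 4)| := by
  refine ciSup_le fun m => ?_
  have p₁ : (0 : ℝ) < n₁ := by exact_mod_cast h₁
  have p₂ : (0 : ℝ) < n₂ := by exact_mod_cast h₂
  -- Threshold `1/2` has virtual value `0`, so `m₂` drops out; threshold `1 - s` contributes `-(2s -
  -- 1)m₁`.
  have t1 := topVirtualSum_le (fun i : Fin n₁ => θ (Sum.inl i)) (m := m.1.val) (by omega)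
    (1 - optimalShare n₁ n₂)
  have t2 := topVirtualSum_le (fun i : Fin n₂ => θ (Sum.inr i)) (m := m.2.val) (by omega) (1 / 2)
  have hm1 : (m.1.val : ℝ) ≤ n₁ := by exact_mod_cast Nat.lt_succ_iff.1 m.1.2
  have h5 : 0 ≤ ((m.1.val : ℝ) + m.2.val) * c := by positivity
  have h6 : (0 : ℝ) ≤ m.1.val := by positivity
  have hD := marginalProfit_nonneg p₁ p₂
  have hD' := marginalProfit_mul p₁ p₂
  have hs := two_thirds_le_optimalShare p₁ p₂
  have hM : marginalProfit n₁ n₂ =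
    n₁ * (2 * optimalShare n₁ n₂ - 3 * optimalShare n₁ n₂ ^ 2) + n₂ / 4 := rfl
  rw [profitFormula_eq p₁ p₂, virtualSurplus, totalExcess_apply, Fintype.sum_sum_type]
  simp only [Sum.elim_inl, Sum.elim_inr, excess]
  generalize optimalShare (n₁ : ℝ) n₂ = s at *
  generalize marginalProfit (n₁ : ℝ) n₂ = D at *
  generalize ∑ i : Fin n₁, max (2 * (θ (Sum.inl i) - (1 - s))) 0 = A at *
  generalize ∑ i : Fin n₂, max (2 * (θ (Sum.inr i) - 1 / 2)) 0 = B at *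
  generalize topVirtualSum m.1.val (fun i : Fin n₁ => θ (Sum.inl i)) = T₁ at *
  generalize topVirtualSum m.2.val (fun i : Fin n₂ => θ (Sum.inr i)) = T₂ at *
  generalize (m.1.val : ℝ) = x at *
  have h7 : x * (T₁ + T₂) ≤ x * (A + B - x * (2 * s - 1)) :=
    mul_le_mul_of_nonneg_left (by linarith) h6
  have h8 : x * (A + B - (n₁ * s ^ 2 + n₂ / 4)) ≤ n₁ * |A + B - (n₁ * s ^ 2 + n₂ / 4)| :=
    (mul_le_mul_of_nonneg_left (le_abs_self _) h6).trans
      (mul_le_mul_of_nonneg_right hm1 (abs_nonneg _))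
  have h9 : 0 ≤ (2 * s - 1) * (x - n₁ * s) ^ 2 := mul_nonneg (by linarith) (sq_nonneg _)
  have h10 : 0 ≤ (n₁ - x) * D := mul_nonneg (by linarith) hD
  -- With the excess replaced by its mean, the bound is a concave quadratic in `x = m₁`; slackness
  -- makes it equal `Π` at `x = n₁s`, and the gap elsewhere is nonnegative by `h9` and `h10`.
  have e : n₁ ^ 2 * s ^ 2 * (1 - s) + n₁ * n₂ * s / 4 + x * (A + B - (n₁ * s ^ 2 + n₂ / 4)) -
      x * (A + B - x * (2 * s - 1)) = (2 * s - 1) * (x - n₁ * s) ^ 2 + (n₁ - x) * D := by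
    linear_combination (x - n₁ * s) * hM - n₁ * hD'
  linarith

lemma virtualProfit_le (hc : 0 ≤ c) (h₁ : 0 < n₁) (h₂ : 0 < n₂) :
    virtualProfit n₁ n₂ c ≤ profitFormula n₁ n₂ + n₁ * √(n₁ + n₂) := by
  have p₁ : (0 : ℝ) < n₁ := by exact_mod_cast h₁
  have p₂ : (0 : ℝ) < n₂ := by exact_mod_cast h₂
  set τ : User n₁ n₂ → ℝ := Sum.elim (fun _ => 1 - optimalShare n₁ n₂) fun _ => 1 / 2 with hτdef
  have hτ : ∀ i, τ i ∈ Set.Icc (0 : ℝ) 1 := by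
    have h3 := two_thirds_le_optimalShare p₁ p₂
    have h4 := optimalShare_le_one p₁ p₂
    rintro (i | i) <;> constructor <;> simp only [hτdef, Sum.elim_inl, Sum.elim_inr] <;> linarith
  have hsum : ∑ i, (1 - τ i) ^ 2 = n₁ * optimalShare n₁ n₂ ^ 2 + n₂ / 4 := by
    simp [hτdef, Fintype.sum_sum_type]
    ring
  have hdev := integral_abs_totalExcess_sub_le hτ
  rw [hsum] at hdev
  have hL : Integrable (fun θ => |totalExcess τ θ - (n₁ * optimalShare n₁ n₂ ^ 2 + n₂ / 4)|)
      (law n₁ n₂) :=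
    (((memLp_totalExcess hτ).integrable one_le_two).sub (integrable_const _)).abs
  rw [virtualProfit_eq]
  calc _ ≤ ∫ θ, (profitFormula n₁ n₂ +
        n₁ * |totalExcess τ θ - (n₁ * optimalShare n₁ n₂ ^ 2 + n₂ / 4)|) ∂law n₁ n₂ :=
        integral_mono (integrable_maxVirtualSurplus hc) ((integrable_const _).add (hL.const_mul _))
          (maxVirtualSurplus_le_excess hc h₁ h₂)
    _ = profitFormula n₁ n₂ +
        n₁ * ∫ θ, |totalExcess τ θ - (n₁ * optimalShare n₁ n₂ ^ 2 + n₂ / 4)| ∂law n₁ n₂ := by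
        rw [integral_add (integrable_const _) (hL.const_mul _), integral_const_mul]
        simp
    _ ≤ _ := by gcongr

end Concentration

end TwoSidedMarket

/-! ### Assembly of the asymptotics and the comparative statics. -/

theorem mainTheorem7 :
    (∀ (c k : ℝ) (n₁ n₂ : ℕ → ℕ), 0 ≤ c → 0 < k → Tendsto n₂ atTop atTop →
      Tendsto (fun j => (n₁ j : ℝ) / n₂ j) atTop (𝓝 k) →
      -- optimal uniform prices exist, and all of them have the stated asymptotics
      (∀ j, ∃ P, TwoSidedMarket.IsOptimalUniformPrices (n₁ j) (n₂ j) c P) ∧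
      (∀ P : ℕ → ℝ × ℝ,
        (∀ᶠ j in atTop, TwoSidedMarket.IsOptimalUniformPrices (n₁ j) (n₂ j) c (P j)) →
        (fun j => (P j).1 - TwoSidedMarket.priceFormula₁ (n₁ j) (n₂ j))
            =o[atTop] (fun j => (n₂ j : ℝ)) ∧
        (k < 1 / 4 → ∀ᶠ j in atTop, (P j).1 = 0) ∧
        (k ≠ 1 / 4 →
          (fun j => (P j).1) ~[atTop] (fun j => TwoSidedMarket.priceFormula₁ (n₁ j) (n₂ j))) ∧
        (fun j => (P j).2) ~[atTop] (fun j => TwoSidedMarket.priceFormula₂ (n₁ j) (n₂ j))) ∧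
      -- the optimal profits
      (fun j => TwoSidedMarket.profitU (n₁ j) (n₂ j) c) ~[atTop]
        (fun j => TwoSidedMarket.profitFormula (n₁ j) (n₂ j)) ∧
      (fun j => TwoSidedMarket.profitD (n₁ j) (n₂ j) c) ~[atTop]
        (fun j => TwoSidedMarket.profitFormula (n₁ j) (n₂ j)) ∧
      (fun j => TwoSidedMarket.virtualProfit (n₁ j) (n₂ j) c) ~[atTop]
        (fun j => TwoSidedMarket.profitFormula (n₁ j) (n₂ j)) ∧
      Tendsto (fun j => TwoSidedMarket.profitU (n₁ j) (n₂ j) c /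
        TwoSidedMarket.profitD (n₁ j) (n₂ j) c) atTop (𝓝 1)) ∧
    -- monotonicity in the ratio, for a fixed number of pure users or a fixed number of users
    (∀ x₁ x₂ y₁ y₂ : ℝ, 0 < x₁ → 0 < x₂ → 0 < y₁ → 0 < y₂ →
      (x₂ = y₂ ∨ x₁ + x₂ = y₁ + y₂) → x₁ / x₂ < y₁ / y₂ →
      TwoSidedMarket.priceFormula₁ x₁ x₂ ≤ TwoSidedMarket.priceFormula₁ y₁ y₂ ∧
      (1 / 4 ≤ x₁ / x₂ →
        TwoSidedMarket.priceFormula₁ x₁ x₂ < TwoSidedMarket.priceFormula₁ y₁ y₂) ∧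
      TwoSidedMarket.priceFormula₂ x₁ x₂ < TwoSidedMarket.priceFormula₂ y₁ y₂ ∧
      TwoSidedMarket.profitFormula x₁ x₂ < TwoSidedMarket.profitFormula y₁ y₂) := by

  refine ⟨?_, ?_⟩
  · intro c k n₁ n₂ hc hk hn hr
    have hb : Tendsto (fun j => (n₂ j : ℝ)) atTop atTop := tendsto_natCast_atTop_atTop.comp hn
    have hpos := TwoSidedMarket.eventually_pos_of_ratio hk hb hr
    have hUlow : ∀ᶠ j in atTop, TwoSidedMarket.profitFormula (n₁ j) (n₂ j) -
        c * ((n₁ j : ℝ) + n₂ j) ≤ TwoSidedMarket.profitU (n₁ j) (n₂ j) c := by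
      filter_upwards [hpos] with j hj
      exact TwoSidedMarket.profitFormula_sub_le_profitU hj.1 hj.2 hc
    have hVup : ∀ᶠ j in atTop, TwoSidedMarket.virtualProfit (n₁ j) (n₂ j) c ≤
        TwoSidedMarket.profitFormula (n₁ j) (n₂ j) + 1 * (n₁ j * √((n₁ j : ℝ) + n₂ j)) := by
      filter_upwards [hpos] with j hj
      rw [one_mul]
      exact TwoSidedMarket.virtualProfit_le hc (by exact_mod_cast hj.1) (by exact_mod_cast hj.2)
    have hUD : ∀ j, TwoSidedMarket.profitU (n₁ j) (n₂ j) c ≤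
        TwoSidedMarket.profitD (n₁ j) (n₂ j) c := fun j => TwoSidedMarket.profitU_le_profitD hc
    have hDV : ∀ j, TwoSidedMarket.profitD (n₁ j) (n₂ j) c ≤
        TwoSidedMarket.virtualProfit (n₁ j) (n₂ j) c :=
      fun j => TwoSidedMarket.profitD_le_virtualProfit hc
    have hU := TwoSidedMarket.isEquivalent_profitFormula hk hb hr hUlow
      (hVup.mono fun j hj => ((hUD j).trans (hDV j)).trans hj)
    have hD := TwoSidedMarket.isEquivalent_profitFormula hk hb hr
      (hUlow.mono fun j hj => hj.trans (hUD j)) (hVup.mono fun j hj => (hDV j).trans hj)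
    have hV := TwoSidedMarket.isEquivalent_profitFormula hk hb hr
      (hUlow.mono fun j hj => hj.trans ((hUD j).trans (hDV j))) hVup
    refine ⟨fun j => TwoSidedMarket.exists_isOptimalUniformPrices _ _ _, fun P hP => ?_,
      hU, hD, hV, ?_⟩
    · have hzero : k < 1 / 4 → ∀ᶠ j in atTop, (P j).1 = 0 := fun hk' =>
        TwoSidedMarket.eventually_price₁_eq_zero hc hk hk' hb hr hP
      refine ⟨TwoSidedMarket.isLittleO_price₁ hc hk hb hr hP, hzero, fun hne => ?_,
        TwoSidedMarket.isEquivalent_price₂ hc hk hb hr hP⟩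
      rcases lt_or_gt_of_ne hne with hk' | hk'
      · apply EventuallyEq.isEquivalent
        filter_upwards [hzero hk', hr.eventually_lt_const hk'] with j hj hj'
        rw [hj, TwoSidedMarket.priceFormula₁, if_pos hj']
      · exact TwoSidedMarket.isEquivalent_price₁_of_quarter_lt hc hk' hb hr hP
    · refine (isEquivalent_iff_tendsto_one ?_).1 (hU.trans hD.symm)
      -- The quotient needs `Π_D ≠ 0` eventually: a zero of `Π_D` would force a zero of the positive
      -- `Π`.
      filter_upwards [hpos, hD.isTheta.2.eq_zero_imp] with j hj hj' h0
      have := TwoSidedMarket.quarter_mul_le_profitFormula hj.1 hj.2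
      have h1 := mul_pos hj.1 hj.2
      rw [hj' h0] at this
      linarith
  · intro x₁ x₂ y₁ y₂ hx₁ hx₂ hy₁ hy₂ h hr
    obtain ⟨hlt, hs⟩ := TwoSidedMarket.lt_and_le_of_ratio_lt hx₁ hx₂ hy₂ h hr
    exact ⟨TwoSidedMarket.priceFormula₁_mono hx₁ hx₂ hy₁ hy₂ hlt hr,
      TwoSidedMarket.priceFormula₁_lt hx₁ hx₂ hy₁ hy₂ hlt hr,
      TwoSidedMarket.priceFormula₂_lt hx₁ hx₂ hy₁ hy₂ hlt hs hr,
      TwoSidedMarket.profitFormula_lt hx₁ hx₂ hy₁ hy₂ hlt hs hr⟩
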